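/- Let $d$ be a positive integer and $d/2<\beta\le d$. Let $\psi:\mathbb R^d\to[0,\infty)$ be continuous, even and positively homogeneous of degree $\beta$, with $c|\xi|^\beta\le\psi(\xi)\le C|\xi|^\beta$ for some $0<c<C<\infty$. Let $X=(X_r)_{r\ge0}$ and $X'=(X'_r)_{r\ge0}$ be independent symmetric stable processes of index $\beta$ in $\mathbb R^d$ with the same characteristic exponent $\psi$, that is, Lévy processes with $E\,e^{i\xi\cdot(X_{r+h}-X_r)}=e^{-h\psi(\xi)}$ and likewise for $X'$, and let $P^{(x_0,y_0)}$ be their joint law when $X$ is started at $x_0$ and $X'$ at $y_0$. Let $f$ be a nonnegative, even Schwartz function on $\mathbb R^d$ with $\int f\,dx=1$, put $f_\varepsilon(x)=\varepsilon^{-d}f(x/\varepsilon)$, and for $s,t\ge0$ let $$\alpha_{s,t}=\lim_{\varepsilon\downarrow0}\int_0^s\!\int_0^t f_\varepsilon(X_r-X'_u)\,du\,dr$$ be the intersection local time of $X$ and $X'$. This limit exists in $L^1(P^{(x_0,y_0)})$. The law of $X_1$ for the process started at the origin has a continuous density $p_1$. If $\beta<d$, then $$E^{(x_0,y_0)}(\alpha_{s,t})\le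 c_\psi\left[s^{2-d/\beta}+t^{2-d/\beta}-(s+t)^{2-d/\beta}\right],\qquad c_\psi=\frac{p_1(0)}{(d/\beta-1)(2-d/\beta)},$$ with equality if $x_0=y_0$. If $\beta=d$, then $$E^{(x_0,y_0)}(\alpha_{s,t})\le p_1(0)\left[(s+t)\log(s+t)-t\log t-s\log s\right]$$ (with $0\log 0=0$), with equality if $x_0=y_0$. -/

import Mathlib

open MeasureTheory ProbabilityTheory Filter Topology
open scoped NNReal ENNReal

/-- The space `ℝ^d` with its Euclidean norm and inner product. -/
abbrev Rn (d : ℕ) : Type := EuclideanSpace ℝ (Fin d)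

/-- The conditions on the characteristic exponent of a nondegenerate symmetric stable process
of index `β` in `ℝ^d`: `ψ` is continuous, positively homogeneous of degree `β`, even, and
comparable to `|·|^β`. -/
structure IsStableExponent {d : ℕ} (β : ℝ) (ψ : Rn d → ℝ) : Prop where
  continuous : Continuous ψ
  homogeneous : ∀ (r : ℝ) (ξ : Rn d), 0 ≤ r → ψ (r • ξ) = r ^ β * ψ ξ
  even : ∀ ξ, ψ (-ξ) = ψ ξ
  bounds : ∃ c C : ℝ, 0 < c ∧ c < C ∧ ∀ ξ : Rn d, c * ‖ξ‖ ^ β ≤ ψ ξ ∧ ψ ξ ≤ C * ‖ξ‖ ^ β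

/-- A path indexed by `[0, ∞)` which is right continuous and has left limits. -/
def IsCadlagPath {d : ℕ} (w : ℝ≥0 → Rn d) : Prop :=
  ∀ t, ContinuousWithinAt w (Set.Ici t) t ∧ ∃ l, Tendsto w (𝓝[<] t) (𝓝 l)

/-- `X` is, under `P`, a symmetric stable process in `ℝ^d` of index `β` with characteristic
exponent `ψ`, started at `x`: a Lévy process whose increment over a time interval of length `h`
has characteristic function `ξ ↦ exp (-h ψ(ξ))`. -/
structure IsSymmetricStableProcess {Ω : Type*} [MeasurableSpace Ω] (P : Measure Ω) {d : ℕ}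
    (β : ℝ) (ψ : Rn d → ℝ) (x : Rn d) (X : ℝ≥0 → Ω → Rn d) : Prop where
  exponent : IsStableExponent β ψ
  measurable : ∀ t, Measurable (X t)
  start : ∀ᵐ ω ∂P, X 0 ω = x
  indep_increments : HasIndepIncrements X P
  charFun_increment : ∀ (r h : ℝ≥0) (ξ : Rn d),
    charFun (P.map (fun ω => X (r + h) ω - X r ω)) ξ = ((Real.exp (-(h : ℝ) * ψ ξ) : ℝ) : ℂ)
  cadlag : ∀ᵐ ω ∂P, IsCadlagPath (fun t => X t ω)

/-- `p` is the continuous density of the measure `ν` on `ℝ^d` with respect to Lebesgue measure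
(there is at most one such function). -/
structure IsContinuousDensity {d : ℕ} (ν : Measure (Rn d)) (p : Rn d → ℝ) : Prop where
  continuous : Continuous p
  nonneg : ∀ x, 0 ≤ p x
  density : ν = volume.withDensity (fun x => ENNReal.ofReal (p x))

/-- A positive, symmetric Schwartz function of integral one. -/
structure IsMollifier {d : ℕ} (f : SchwartzMap (Rn d) ℝ) : Prop where
  nonneg : ∀ x, 0 ≤ f x
  even : ∀ x, f (-x) = f x
  integral_eq_one : ∫ x, f x = 1

/-- The approximate delta function `f_ε(x) = f(x / ε) / ε^d`. -/
noncomputable def approxDelta {d : ℕ} (f : SchwartzMap (Rn d) ℝ) (ε : ℝ) (x : Rn d) : ℝ :=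
  f (ε⁻¹ • x) / ε ^ d

/-- `α_{s,t,ε} = ∫_0^s ∫_0^t f_ε(X_r - X'_u) du dr`. -/
noncomputable def approxIntersectionLocalTime {Ω : Type*} {d : ℕ}
    (f : SchwartzMap (Rn d) ℝ) (X X' : ℝ≥0 → Ω → Rn d) (s t ε : ℝ) (ω : Ω) : ℝ :=
  ∫ r in (0 : ℝ)..s, ∫ u in (0 : ℝ)..t, approxDelta f ε (X r.toNNReal ω - X' u.toNNReal ω)

/-- `α` is (a version of) the intersection local time `α_{s,t}` of `X` and `X'`: the limit in
`L¹(P)` of `α_{s,t,ε}` as `ε` decreases to zero. Such an `α` is unique up to null sets. -/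
structure IsIntersectionLocalTime {Ω : Type*} [MeasurableSpace Ω] (P : Measure Ω) {d : ℕ}
    (f : SchwartzMap (Rn d) ℝ) (X X' : ℝ≥0 → Ω → Rn d) (s t : ℝ) (α : Ω → ℝ) : Prop where
  integrable : Integrable α P
  approx_integrable : ∀ ε : ℝ, 0 < ε → Integrable (approxIntersectionLocalTime f X X' s t ε) P
  tendsto : Tendsto
    (fun ε : ℝ => eLpNorm (fun ω => approxIntersectionLocalTime f X X' s t ε ω - α ω) 1 P)
    (𝓝[>] 0) (𝓝 0)

/-! Write `f_ε(x) = ∫ e^{i⟨x,ξ⟩} h(εξ) dξ`, where `h` is bounded, continuous and integrable with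
`h(0) = (2π)^{-d}`. Integrating over times gives `α_{s,t,ε} = ∫ B_ξ h(εξ) dξ`, where `B_ξ = ∫_0^s
∫_0^t e^{i⟨X_r - X'_u, ξ⟩} du dr` (`occupationFourier`) does not depend on `ε`. Limits in `ε` then
follow by dominated convergence once the moments of `B` are integrable in frequency.

Mean: independence gives `E B_ξ = e^{i⟨x₀-y₀,ξ⟩} G_s(ψ(ξ)) G_t(ψ(ξ))` with `G_s(a) = ∫_0^s e^{-ra}
dr ≤ e^s/(1+a)`. This is integrable because `(1+ψ)^{-2}` is, which is where `β > d/2` enters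
(`integrable_invOneAdd_sq`). Hence `E α = (2π)^{-d} ∫ cos⟨x₀-y₀,ξ⟩ G_s(ψ) G_t(ψ) dξ`. Replacing the
cosine by 1 gives the upper bound, with equality when `x₀ = y₀`. By Fubini and the scaling `∫
e^{-rψ} = r^{-d/β} ∫ e^{-ψ}`, that bound equals `p₁(0) ∫_0^s ∫_0^t (r+u)^{-d/β} du dr`, an
elementary integral (`IsStableExponent.integral_expIntegral_mul`).

Existence: with `g = 1/(1+ψ)`, independent increments give `|E B_ξ B_η| ≤ e^{s+t}
[g(ξ+η)(g(ξ)+g(η))]²`, integrable over both frequencies. So the approximations are Cauchy in `L²`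
and converge in `L¹`.

The density of `X_1 - x₀` comes from Fourier inversion, and `p₁(0) = (2π)^{-d} ∫ e^{-ψ}`. -/

open FourierTransform

/-! ### Characters and the Fourier representation of the mollifier -/

/-- The character `x ↦ exp (i ⟪x, ξ⟫)`. -/
noncomputable def ch {d : ℕ} (ξ x : Rn d) : ℂ := Complex.exp ((inner ℝ x ξ : ℝ) * Complex.I)

section Character

variable {d : ℕ}

@[simp] lemma norm_ch (ξ x : Rn d) : ‖ch ξ x‖ = 1 := Complex.norm_exp_ofReal_mul_I _

@[simp] lemma ch_zero_right (ξ : Rn d) : ch ξ 0 = 1 := by simp [ch]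

lemma ch_add_right (ξ x y : Rn d) : ch ξ (x + y) = ch ξ x * ch ξ y := by
  simp [ch, inner_add_left, add_mul, Complex.exp_add]

lemma ch_add_left (ξ η x : Rn d) : ch (ξ + η) x = ch ξ x * ch η x := by
  simp [ch, inner_add_right, add_mul, Complex.exp_add]

lemma ch_neg_left (ξ x : Rn d) : ch (-ξ) x = ch ξ (-x) := by simp [ch]

lemma ch_sub_right (ξ x y : Rn d) : ch ξ (x - y) = ch ξ x * ch (-ξ) y := by
  rw [sub_eq_add_neg, ch_add_right, ch_neg_left]

lemma continuous_ch : Continuous (fun p : Rn d × Rn d => ch p.1 p.2) := by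
  unfold ch; fun_prop

lemma charFun_eq_integral_ch (μ : Measure (Rn d)) (ξ : Rn d) :
    charFun μ ξ = ∫ x, ch ξ x ∂μ := rfl

end Character

/-- The constant `(2π)^{-d}` of the Fourier inversion formula. -/
noncomputable def invTwoPi (d : ℕ) : ℝ := ((2 * Real.pi) ^ d)⁻¹

lemma invTwoPi_pos (d : ℕ) : 0 < invTwoPi d := by unfold invTwoPi; positivity

lemma integral_two_pi_smul {d : ℕ} (u : Rn d → ℂ) :
    ∫ ξ, u ((2 * Real.pi) • ξ) = invTwoPi d * ∫ ξ, u ξ := by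
  rw [Measure.integral_comp_smul, invTwoPi, finrank_euclideanSpace_fin,
    abs_of_pos (by positivity)]
  simp [Complex.real_smul]

/-- The Fourier integral in terms of characters. -/
lemma fourier_eq_integral_ch {d : ℕ} (u : Rn d → ℂ) (ξ : Rn d) :
    𝓕 u ξ = ∫ x, ch (-((2 * Real.pi) • ξ)) x * u x := by
  rw [Real.fourier_eq']
  refine integral_congr_ae (Eventually.of_forall fun x => ?_)
  simp only [ch, smul_eq_mul, inner_neg_right, inner_smul_right]
  congr 3; push_cast; ring

lemma fourierInv_eq_integral_ch {d : ℕ} (u : Rn d → ℂ) (x : Rn d) :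
    𝓕⁻ u x = ∫ ξ, ch ((2 * Real.pi) • ξ) x * u ξ := by
  rw [Real.fourierInv_eq']
  refine integral_congr_ae (Eventually.of_forall fun ξ => ?_)
  simp only [ch, smul_eq_mul, inner_smul_right, real_inner_comm]

/-- `f_ε` is a superposition of characters: `f_ε(x) = ∫ exp (i ⟪x, ξ⟫) h(ε ξ) dξ`. -/
structure IsFourierProfile {d : ℕ} (f : SchwartzMap (Rn d) ℝ) (h : Rn d → ℂ) : Prop where
  continuous : Continuous h
  integrable : Integrable h
  bounded : ∃ M, 0 ≤ M ∧ ∀ ξ, ‖h ξ‖ ≤ M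
  zero : h 0 = invTwoPi d
  repr : ∀ ε : ℝ, 0 < ε → ∀ x, (approxDelta f ε x : ℂ) = ∫ ξ, ch ξ x * h (ε • ξ)

/-- Fourier inversion for Schwartz functions, with the `2π` moved from the exponent into the profile
`h(ξ) = (2π)^{-d} F(ξ/2π)`. Its value at 0 comes from `∫ f = 1`, and a dilation of the frequency
handles general `ε`. -/
lemma IsMollifier.exists_profile {d : ℕ} {f : SchwartzMap (Rn d) ℝ} (hf : IsMollifier f) :
    ∃ h, IsFourierProfile f h := by
  let fc : SchwartzMap (Rn d) ℂ := SchwartzMap.postcompCLM Complex.ofRealCLM f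
  have hfc : ∀ x, fc x = (f x : ℂ) := fun x => rfl
  have h2 : (0 : ℝ) < 2 * Real.pi := by positivity
  set F : SchwartzMap (Rn d) ℂ := 𝓕 fc with hF
  have inv : ∀ x, (f x : ℂ) = ∫ ξ, ch ξ x * (invTwoPi d * F ((2 * Real.pi)⁻¹ • ξ)) := by
    intro x
    have h1 : 𝓕⁻ (𝓕 (fc : Rn d → ℂ)) = fc :=
      fc.continuous.fourierInv_fourier_eq fc.integrable (by
        rw [← SchwartzMap.fourier_coe]; exact F.integrable)
    rw [← hfc, ← h1, fourierInv_eq_integral_ch, ← SchwartzMap.fourier_coe, ← hF]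
    have := integral_two_pi_smul (fun ξ => ch ξ x * F ((2 * Real.pi)⁻¹ • ξ))
    simp only [smul_smul, inv_mul_cancel₀ h2.ne', one_smul] at this
    rw [this, ← integral_const_mul]
    congr 1; ext ξ; ring
  refine ⟨fun ξ => invTwoPi d * F ((2 * Real.pi)⁻¹ • ξ), ?_, ?_, ?_, ?_, ?_⟩
  · have := F.continuous; fun_prop
  · exact ((F.integrable (μ := volume)).comp_smul (inv_ne_zero h2.ne')).const_mul _
  · obtain ⟨M, hM⟩ : ∃ M, ∀ ξ, ‖F ξ‖ ≤ M := by
      obtain ⟨C, hC⟩ := F.decay 0 0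
      exact ⟨C, fun ξ => by simpa using hC.2 ξ⟩
    refine ⟨invTwoPi d * M, mul_nonneg (invTwoPi_pos d).le ((norm_nonneg _).trans (hM 0)),
      fun ξ => ?_⟩
    rw [norm_mul, Complex.norm_real, Real.norm_of_nonneg (invTwoPi_pos d).le]
    exact mul_le_mul_of_nonneg_left (hM _) (invTwoPi_pos d).le
  · have : F 0 = 1 := by
      rw [hF, SchwartzMap.fourier_coe, fourier_eq_integral_ch]
      simp only [smul_zero, ch, neg_zero, inner_zero_right, hfc]
      simp [integral_complex_ofReal, hf.integral_eq_one]
    simp [this]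
  · intro ε hε x
    have := Measure.integral_comp_smul volume
      (fun ξ => ch ξ (ε⁻¹ • x) * (invTwoPi d * F ((2 * Real.pi)⁻¹ • ξ))) ε
    rw [← inv] at this
    rw [approxDelta, Complex.ofReal_div, div_eq_inv_mul]
    have e : ∀ ξ, ch (ε • ξ) (ε⁻¹ • x) = ch ξ x := by
      intro ξ; simp [ch, inner_smul_left, inner_smul_right, hε.ne']
    simp only [e, finrank_euclideanSpace_fin] at this
    rw [this, abs_of_pos (by positivity)]
    simp [Complex.real_smul]

/-! ### Fourier inversion for a probability measure with integrable real characteristic function -/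

section InversionDensity

variable {d : ℕ}

lemma SchwartzMap.exists_norm_le (f : SchwartzMap (Rn d) ℝ) : ∃ M, 0 ≤ M ∧ ∀ x, ‖f x‖ ≤ M := by
  obtain ⟨C, hC⟩ := f.decay 0 0
  exact ⟨C, hC.1.le, fun ξ => by simpa using hC.2 ξ⟩

lemma continuous_approxDelta (f : SchwartzMap (Rn d) ℝ) (ε : ℝ) : Continuous (approxDelta f ε) := by
  unfold approxDelta
  exact (f.continuous.comp (continuous_const_smul _)).div_const _

lemma approxDelta_bounded (f : SchwartzMap (Rn d) ℝ) (ε : ℝ) :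
    ∃ M, 0 ≤ M ∧ ∀ x, ‖approxDelta f ε x‖ ≤ M := by
  obtain ⟨M, hM, h⟩ := f.exists_norm_le
  refine ⟨M / |ε ^ d|, by positivity, fun x => ?_⟩
  rw [approxDelta, norm_div, Real.norm_eq_abs (ε ^ d)]
  gcongr
  exact h _

lemma IsMollifier.lintegral_approxDelta {f : SchwartzMap (Rn d) ℝ} (hf : IsMollifier f) {ε : ℝ}
    (hε : 0 < ε) : ∫⁻ x, ENNReal.ofReal (approxDelta f ε x) = 1 := by
  have hi : Integrable (approxDelta f ε) := by
    unfold approxDelta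
    exact ((f.integrable (μ := volume)).comp_smul (inv_ne_zero hε.ne')).div_const _
  rw [← ofReal_integral_eq_lintegral_ofReal hi
    (Eventually.of_forall fun x => div_nonneg (hf.nonneg _) (by positivity))]
  simp only [approxDelta]
  rw [integral_div, Measure.integral_comp_smul, finrank_euclideanSpace_fin, hf.integral_eq_one,
    abs_of_pos (by positivity)]
  have : ε ^ d ≠ 0 := by positivity
  simp [this]

/-- The Fourier integral of a characteristic function. -/
noncomputable def inversionIntegral (φ : Rn d → ℝ) (x : Rn d) : ℂ :=
  invTwoPi d * ∫ ξ, ch ξ x * φ ξ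

variable {ν : Measure (Rn d)} [IsProbabilityMeasure ν] {φ : Rn d → ℝ}
  {f : SchwartzMap (Rn d) ℝ} {h : Rn d → ℂ}

omit [IsProbabilityMeasure ν] in
lemma charFun_even_of_real (hch : ∀ ξ, charFun ν ξ = φ ξ) (ξ : Rn d) : φ (-ξ) = φ ξ := by
  have := charFun_neg (μ := ν) ξ
  rw [hch, hch, Complex.conj_ofReal] at this
  exact_mod_cast this

/-- Parseval's identity. The reflected frequency produced by `x - y` disappears because a real
characteristic function is even. -/
lemma IsFourierProfile.integral_approxDelta (hh : IsFourierProfile f h)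
    (hch : ∀ ξ, charFun ν ξ = φ ξ) {ε : ℝ} (hε : 0 < ε) (x : Rn d) :
    ((∫ y, approxDelta f ε (x - y) ∂ν : ℝ) : ℂ) = ∫ ξ, ch ξ x * h (ε • ξ) * φ ξ := by
  rw [← integral_complex_ofReal]
  simp only [hh.repr ε hε]
  rw [integral_integral_swap]
  · refine integral_congr_ae (Eventually.of_forall fun ξ => ?_)
    simp only [ch_sub_right]
    have : ∀ y, ch ξ x * ch (-ξ) y * h (ε • ξ) = (ch ξ x * h (ε • ξ)) * ch (-ξ) y := fun y => by ring
    simp only [this]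
    rw [integral_const_mul, ← charFun_eq_integral_ch, hch, charFun_even_of_real hch]
  · have h1 : Integrable (fun p : Rn d × Rn d => h (ε • p.2)) (ν.prod volume) :=
      (hh.integrable.comp_smul hε.ne').comp_snd ν
    refine h1.bdd_mul (c := 1) (f := fun p : Rn d × Rn d => ch p.2 (x - p.1)) ?_ ?_
    · exact (continuous_ch.comp (by fun_prop :
        Continuous fun p : Rn d × Rn d => (p.2, x - p.1))).aestronglyMeasurable
    · simp

lemma tendsto_integral_approxDelta (hh : IsFourierProfile f h) (hφi : Integrable φ)
    (hch : ∀ ξ, charFun ν ξ = φ ξ) (x : Rn d) :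
    Tendsto (fun ε : ℝ => ((∫ y, approxDelta f ε (x - y) ∂ν : ℝ) : ℂ)) (𝓝[>] 0)
      (𝓝 (inversionIntegral φ x)) := by
  obtain ⟨M, hM, hb⟩ := hh.bounded
  have h1 : Tendsto (fun ε : ℝ => ∫ ξ, ch ξ x * h (ε • ξ) * φ ξ) (𝓝[>] 0)
      (𝓝 (∫ ξ, ch ξ x * h 0 * φ ξ)) := by
    refine tendsto_integral_filter_of_dominated_convergence (fun ξ => M * ‖φ ξ‖) ?_ ?_ ?_ ?_
    · refine Eventually.of_forall fun ε => ?_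
      refine AEStronglyMeasurable.mul ?_
        (Complex.continuous_ofReal.comp_aestronglyMeasurable hφi.aestronglyMeasurable)
      refine Continuous.aestronglyMeasurable ?_
      exact (continuous_ch.comp (by fun_prop : Continuous fun ξ : Rn d => (ξ, x))).mul
        (hh.continuous.comp (by fun_prop))
    · refine Eventually.of_forall fun ε => Eventually.of_forall fun ξ => ?_
      rw [norm_mul, norm_mul, norm_ch, one_mul, Complex.norm_real]
      gcongr
      exact hb _
    · exact hφi.norm.const_mul _
    · refine Eventually.of_forall fun ξ => ?_
      refine Tendsto.mul_const _ (Tendsto.const_mul _ ?_)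
      have : Tendsto (fun ε : ℝ => h (ε • ξ)) (𝓝 0) (𝓝 (h ((0 : ℝ) • ξ))) :=
        (hh.continuous.comp (by fun_prop : Continuous fun ε : ℝ => ε • ξ)).tendsto 0
      rw [zero_smul] at this
      exact this.mono_left nhdsWithin_le_nhds
  have h2 : ∫ ξ, ch ξ x * h 0 * φ ξ = inversionIntegral φ x := by
    rw [inversionIntegral, ← integral_const_mul, hh.zero]
    congr 1; ext ξ; ring
  rw [← h2]
  refine h1.congr' ?_
  filter_upwards [self_mem_nhdsWithin] with ε hε
  rw [hh.integral_approxDelta hch hε]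

lemma tendsto_re_inversionIntegral (hh : IsFourierProfile f h) (hφi : Integrable φ)
    (hch : ∀ ξ, charFun ν ξ = φ ξ) (x : Rn d) :
    Tendsto (fun ε : ℝ => ∫ y, approxDelta f ε (x - y) ∂ν) (𝓝[>] 0)
      (𝓝 (inversionIntegral φ x).re) :=
  (Complex.continuous_re.tendsto _).comp (tendsto_integral_approxDelta hh hφi hch x)

lemma inversionIntegral_eq_re (hh : IsFourierProfile f h) (hφi : Integrable φ)
    (hch : ∀ ξ, charFun ν ξ = φ ξ) (x : Rn d) :
    inversionIntegral φ x = (inversionIntegral φ x).re := by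
  refine tendsto_nhds_unique (tendsto_integral_approxDelta hh hφi hch x) ?_
  exact (Complex.continuous_ofReal.tendsto _).comp (tendsto_re_inversionIntegral hh hφi hch x)

/-- The inverse transform is the pointwise limit of the nonnegative mollifications of `ν`. -/
lemma re_inversionIntegral_nonneg (hf : IsMollifier f) (hh : IsFourierProfile f h)
    (hφi : Integrable φ) (hch : ∀ ξ, charFun ν ξ = φ ξ) (x : Rn d) :
    0 ≤ (inversionIntegral φ x).re := by
  refine ge_of_tendsto (tendsto_re_inversionIntegral hh hφi hch x) ?_
  filter_upwards [self_mem_nhdsWithin] with ε hε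
  exact integral_nonneg fun y => div_nonneg (hf.nonneg _) (pow_nonneg (le_of_lt hε) _)

lemma continuous_inversionIntegral (hφi : Integrable φ) : Continuous (inversionIntegral φ) := by
  refine continuous_const.mul ?_
  refine continuous_of_dominated (bound := fun ξ => ‖φ ξ‖) ?_ ?_ hφi.norm ?_
  · intro x
    exact (continuous_ch.comp (by fun_prop : Continuous fun ξ : Rn d => (ξ, x))).aestronglyMeasurable.mul
      (Complex.continuous_ofReal.comp_aestronglyMeasurable hφi.aestronglyMeasurable)
  · exact fun x => Eventually.of_forall fun ξ => by simp
  · exact Eventually.of_forall fun ξ =>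
      (continuous_ch.comp (by fun_prop : Continuous fun x : Rn d => (ξ, x))).mul_const _

/-- Fatou's lemma: each mollification of `ν` has total mass 1. This supplies the integrability
needed to invert the transform once more. -/
lemma lintegral_inversionIntegral_le (hf : IsMollifier f) (hh : IsFourierProfile f h)
    (hφi : Integrable φ) (hch : ∀ ξ, charFun ν ξ = φ ξ) :
    ∫⁻ x, ENNReal.ofReal (inversionIntegral φ x).re ≤ 1 := by
  have hu : Tendsto (fun n : ℕ => (1 / ((n : ℝ) + 1))) atTop (𝓝[>] 0) :=
    tendsto_nhdsWithin_iff.2 ⟨tendsto_one_div_add_atTop_nhds_zero_nat,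
      Eventually.of_forall fun n => by simp only [Set.mem_Ioi]; positivity⟩
  have hlim : ∀ x, ENNReal.ofReal (inversionIntegral φ x).re = liminf (fun n : ℕ =>
      ENNReal.ofReal (∫ y, approxDelta f (1 / ((n : ℝ) + 1)) (x - y) ∂ν)) atTop := fun x =>
    (((ENNReal.continuous_ofReal.tendsto _).comp
      ((tendsto_re_inversionIntegral hh hφi hch x).comp hu)).liminf_eq).symm
  have hone : ∀ n : ℕ, ∀ x, ENNReal.ofReal (∫ y, approxDelta f (1 / ((n : ℝ) + 1)) (x - y) ∂ν) =
      ∫⁻ y, ENNReal.ofReal (approxDelta f (1 / ((n : ℝ) + 1)) (x - y)) ∂ν := by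
    intro n x
    refine ofReal_integral_eq_lintegral_ofReal ?_
      (Eventually.of_forall fun y => div_nonneg (hf.nonneg _) (by positivity))
    obtain ⟨M, -, hM⟩ := approxDelta_bounded f (1 / ((n : ℝ) + 1))
    exact Integrable.of_bound ((continuous_approxDelta f _).comp
      (by fun_prop)).aestronglyMeasurable M (Eventually.of_forall fun y => hM _)
  have hmeas : ∀ n : ℕ, Measurable (fun p : Rn d × Rn d =>
      ENNReal.ofReal (approxDelta f (1 / ((n : ℝ) + 1)) (p.1 - p.2))) := fun n =>
    ENNReal.measurable_ofReal.comp ((continuous_approxDelta f _).comp (by fun_prop)).measurable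
  simp only [hlim, hone]
  refine (lintegral_liminf_le fun n => (hmeas n).lintegral_prod_right').trans ?_
  refine liminf_le_of_le (by isBoundedDefault) fun b hb => ?_
  obtain ⟨n, hn⟩ := hb.exists
  refine hn.trans (le_of_eq ?_)
  rw [lintegral_lintegral_swap (hmeas n).aemeasurable]
  have : ∀ y, ∫⁻ x, ENNReal.ofReal (approxDelta f (1 / ((n : ℝ) + 1)) (x - y)) = 1 := fun y => by
    rw [lintegral_sub_right_eq_self (fun x => ENNReal.ofReal (approxDelta f _ x)),
      hf.lintegral_approxDelta (by positivity)]
  simp only [this, lintegral_const, measure_univ, mul_one]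

lemma inversionIntegral_eq_fourierInv (φ : Rn d → ℝ) :
    inversionIntegral φ = 𝓕⁻ (fun ξ => (φ ((2 * Real.pi) • ξ) : ℂ)) := by
  ext x
  rw [fourierInv_eq_integral_ch, inversionIntegral,
    ← integral_two_pi_smul (fun ξ => ch ξ x * φ ξ)]

/-- A probability measure with an integrable real characteristic function has a continuous
density, given by Fourier inversion. -/
theorem isContinuousDensity_inversionIntegral (hf : IsMollifier f) (hh : IsFourierProfile f h)
    (hφc : Continuous φ) (hφi : Integrable φ) (hch : ∀ ξ, charFun ν ξ = φ ξ) :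
    IsContinuousDensity ν (fun x => (inversionIntegral φ x).re) := by
  have h2 : (2 * Real.pi : ℝ) ≠ 0 := by positivity
  have hc : Continuous (inversionIntegral φ) := continuous_inversionIntegral hφi
  have hcr : Continuous (fun x => (inversionIntegral φ x).re) := Complex.continuous_re.comp hc
  have hnn := re_inversionIntegral_nonneg hf hh hφi hch
  have hint : Integrable (fun x => (inversionIntegral φ x).re) := by
    refine ⟨hcr.aestronglyMeasurable, ?_⟩
    rw [hasFiniteIntegral_iff_ofReal (Eventually.of_forall hnn)]
    exact (lintegral_inversionIntegral_le hf hh hφi hch).trans_lt ENNReal.one_lt_top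
  have hfin : IsFiniteMeasure
      (volume.withDensity fun x => ENNReal.ofReal (inversionIntegral φ x).re) :=
    isFiniteMeasure_withDensity_ofReal hint.2
  refine ⟨hcr, hnn, ?_⟩
  refine Measure.ext_of_charFun (funext fun η => ?_)
  have hm : Measurable fun x => ENNReal.ofReal (inversionIntegral φ x).re :=
    ENNReal.measurable_ofReal.comp hcr.measurable
  rw [hch, charFun_eq_integral_ch, integral_withDensity_eq_integral_toReal_smul hm (by simp)]
  -- Transforming the candidate density returns `φ`. The integrability hypothesis concerns the
  -- forward transform of `φ(2π·)`, which is the candidate density reflected.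
  have hinv := Continuous.fourier_fourierInv_eq
    (f := fun ξ : Rn d => (φ ((2 * Real.pi) • ξ) : ℂ)) (by fun_prop)
    ((hφi.comp_smul h2).ofReal) (by
      refine ((hint.ofReal (𝕜 := ℂ)).comp_neg).congr (Eventually.of_forall fun x => ?_)
      refine (inversionIntegral_eq_re hh hφi hch (-x)).symm.trans ?_
      rw [inversionIntegral_eq_fourierInv, Real.fourierInv_eq_fourier_neg, neg_neg])
  have h3 := congrFun hinv (-((2 * Real.pi)⁻¹ • η))
  rw [← inversionIntegral_eq_fourierInv, fourier_eq_integral_ch] at h3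
  simp only [smul_neg, neg_neg, smul_smul, mul_inv_cancel₀ h2, one_smul,
    charFun_even_of_real hch] at h3
  rw [← h3]
  refine integral_congr_ae (Eventually.of_forall fun x => ?_)
  simp only [ENNReal.toReal_ofReal (hnn x), Complex.real_smul]
  rw [← inversionIntegral_eq_re hh hφi hch x, mul_comm]

end InversionDensity

/-- Two densities agree almost everywhere, and continuous functions that do so agree everywhere.
This gives meaning to the value `p₁(0)`. -/
lemma IsContinuousDensity.unique {d : ℕ} {ν : Measure (Rn d)} [SigmaFinite ν] {p q : Rn d → ℝ}
    (hp : IsContinuousDensity ν p) (hq : IsContinuousDensity ν q) : p = q := by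
  have h := hp.density.symm.trans hq.density
  have : SigmaFinite (volume.withDensity fun x => ENNReal.ofReal (p x)) := by
    rw [← hp.density]; infer_instance
  have hm : ∀ {u : Rn d → ℝ}, Continuous u → AEMeasurable fun x => ENNReal.ofReal (u x) :=
    fun hu => (ENNReal.measurable_ofReal.comp hu.measurable).aemeasurable
  rw [withDensity_eq_iff_of_sigmaFinite (hm hp.continuous) (hm hq.continuous)] at h
  refine (hp.continuous.ae_eq_iff_eq volume hq.continuous).1 ?_
  filter_upwards [h] with x hx
  exact (ENNReal.ofReal_eq_ofReal_iff (hp.nonneg x) (hq.nonneg x)).1 hx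

/-! ### Integrability and scaling of the stable exponent -/

section StableExponent

variable {d : ℕ} {β : ℝ} {ψ : Rn d → ℝ}

lemma IsStableExponent.nonneg (hψ : IsStableExponent β ψ) (ξ : Rn d) : 0 ≤ ψ ξ := by
  obtain ⟨c, C, hc, -, h⟩ := hψ.bounds
  exact (by positivity : 0 ≤ c * ‖ξ‖ ^ β).trans (h ξ).1

/-- The resolvent kernel `1 / (1 + ψ)` on the Fourier side. -/
noncomputable def invOneAdd (ψ : Rn d → ℝ) (ξ : Rn d) : ℝ := (1 + ψ ξ)⁻¹

lemma invOneAdd_pos (hψ : IsStableExponent β ψ) (ξ : Rn d) : 0 < invOneAdd ψ ξ := by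
  have := hψ.nonneg ξ
  unfold invOneAdd; positivity

lemma continuous_invOneAdd (hψ : IsStableExponent β ψ) : Continuous (invOneAdd ψ) := by
  refine Continuous.inv₀ (continuous_const.add hψ.continuous) fun ξ => ?_
  have := hψ.nonneg ξ
  positivity

/-- Comparison with `(1+‖ξ‖)^{-2β}`, integrable because `2β > d`. All later frequency integrals are
controlled by this one. -/
lemma integrable_invOneAdd_sq (hψ : IsStableExponent β ψ) (hβ0 : 0 < β) (hβ : (d : ℝ) / 2 < β) :
    Integrable (fun ξ => invOneAdd ψ ξ ^ 2) := by
  obtain ⟨c, C, hc, -, h⟩ := hψ.bounds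
  have hJ : Integrable (fun ξ : Rn d => (1 + ‖ξ‖) ^ (-(2 * β))) :=
    integrable_one_add_norm (by rw [finrank_euclideanSpace_fin]; linarith)
  set a := min 1 c with ha
  have ha0 : 0 < a := lt_min one_pos hc
  refine (hJ.const_mul ((2 ^ β / a) ^ 2)).mono'
    ((continuous_invOneAdd hψ).pow 2).aestronglyMeasurable (Eventually.of_forall fun ξ => ?_)
  have hg := invOneAdd_pos hψ ξ
  have hn := norm_nonneg ξ
  rw [Real.norm_of_nonneg (by positivity), neg_mul_eq_mul_neg, mul_comm (2 : ℝ),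
    Real.rpow_mul (by positivity), Real.rpow_two, ← mul_pow]
  gcongr
  -- In the unit ball the summand 1 suffices; outside it `1 + ‖ξ‖ ≤ 2‖ξ‖` and the lower bound on `ψ`
  -- takes over. The choice `a = min 1 c` serves both cases.
  have key : a * (1 + ‖ξ‖) ^ β ≤ 2 ^ β * (1 + ψ ξ) := by
    rcases le_total ‖ξ‖ 1 with h1 | h1
    · calc a * (1 + ‖ξ‖) ^ β ≤ 1 * 2 ^ β := by
            gcongr
            · exact min_le_left _ _
            · linarith
        _ ≤ 2 ^ β * (1 + ψ ξ) := by
            rw [one_mul]; exact le_mul_of_one_le_right (by positivity) (by linarith [hψ.nonneg ξ])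
    · calc a * (1 + ‖ξ‖) ^ β ≤ c * (2 * ‖ξ‖) ^ β := by
            gcongr
            · exact min_le_right _ _
            · linarith
        _ = 2 ^ β * (c * ‖ξ‖ ^ β) := by rw [Real.mul_rpow (by norm_num) hn]; ring
        _ ≤ 2 ^ β * (1 + ψ ξ) := by gcongr; linarith [(h ξ).1]
  have h1 : 0 < 1 + ψ ξ := by linarith [hψ.nonneg ξ]
  have h2 : 0 < (1 + ‖ξ‖) ^ β := by positivity
  rw [Real.rpow_neg (by positivity), invOneAdd]
  rw [inv_eq_one_div, ← div_eq_mul_inv, div_div, div_le_div_iff₀ h1 (by positivity)]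
  linarith

lemma exp_neg_le_inv_sq {x : ℝ} (hx : 0 ≤ x) : Real.exp (-x) ≤ 2 * ((1 + x)⁻¹) ^ 2 := by
  have h := Real.quadratic_le_exp_of_nonneg hx
  rw [Real.exp_neg, inv_pow, ← div_eq_mul_inv, inv_eq_one_div,
    div_le_div_iff₀ (Real.exp_pos _) (by positivity)]
  nlinarith

lemma integrable_exp_neg_exponent (hψ : IsStableExponent β ψ) (hβ0 : 0 < β)
    (hβ : (d : ℝ) / 2 < β) : Integrable (fun ξ => Real.exp (-ψ ξ)) := by
  refine ((integrable_invOneAdd_sq hψ hβ0 hβ).const_mul 2).mono' ?_ ?_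
  · exact (Real.continuous_exp.comp hψ.continuous.neg).aestronglyMeasurable
  · refine Eventually.of_forall fun ξ => ?_
    rw [Real.norm_of_nonneg (Real.exp_pos _).le]
    exact exp_neg_le_inv_sq (hψ.nonneg ξ)

lemma exp_neg_mul_exponent_eq (hψ : IsStableExponent β ψ) (hβ0 : 0 < β) {r : ℝ} (hr : 0 < r)
    (ξ : Rn d) : Real.exp (-r * ψ ξ) = Real.exp (-ψ (r ^ (1 / β) • ξ)) := by
  rw [hψ.homogeneous _ _ (by positivity), ← Real.rpow_mul hr.le, one_div_mul_cancel hβ0.ne',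
    Real.rpow_one, neg_mul]

/-- Scaling of the integral of the heat kernel on the Fourier side. -/
lemma integral_exp_neg_mul_exponent (hψ : IsStableExponent β ψ) (hβ0 : 0 < β) {r : ℝ}
    (hr : 0 < r) :
    ∫ ξ, Real.exp (-r * ψ ξ) = r ^ (-((d : ℝ) / β)) * ∫ ξ, Real.exp (-ψ ξ) := by
  simp only [exp_neg_mul_exponent_eq hψ hβ0 hr]
  rw [Measure.integral_comp_smul volume (fun ξ => Real.exp (-ψ ξ)), finrank_euclideanSpace_fin,
    abs_of_pos (by positivity), smul_eq_mul, ← Real.rpow_natCast, ← Real.rpow_mul hr.le,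
    ← Real.rpow_neg hr.le]
  congr 2
  ring

end StableExponent

/-! ### Limits of random superpositions of characters -/

section FourierSuperposition

variable {d : ℕ} {Ω : Type*} [MeasurableSpace Ω] {P : Measure Ω} [IsProbabilityMeasure P]
  {f : SchwartzMap (Rn d) ℝ} {h : Rn d → ℂ} {B : Rn d → Ω → ℂ} {a : ℝ → Ω → ℝ}

lemma IsFourierProfile.tendsto_smul (hh : IsFourierProfile f h) (ξ : Rn d) :
    Tendsto (fun ε : ℝ => h (ε • ξ)) (𝓝[>] 0) (𝓝 (h 0)) := by
  have : Tendsto (fun ε : ℝ => h (ε • ξ)) (𝓝 0) (𝓝 (h ((0 : ℝ) • ξ))) :=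
    (hh.continuous.comp (by fun_prop : Continuous fun ε : ℝ => ε • ξ)).tendsto 0
  rw [zero_smul] at this
  exact this.mono_left nhdsWithin_le_nhds

lemma IsFourierProfile.continuous_smul (hh : IsFourierProfile f h) (ε : ℝ) :
    Continuous fun ξ => h (ε • ξ) :=
  hh.continuous.comp (by fun_prop)

/-- Since `b` is real, its square is the product of two copies of the integral without a conjugate;
Fubini then moves the expectation inside. -/
lemma integral_sq_superposition {M : ℝ} (hB : Measurable (Function.uncurry B))
    (hBM : ∀ ξ ω, ‖B ξ ω‖ ≤ M) {D : Rn d → ℂ} (hD : Integrable D) {b : Ω → ℝ}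
    (hb : ∀ ω, (b ω : ℂ) = ∫ ξ, B ξ ω * D ξ) :
    ((∫ ω, b ω ^ 2 ∂P : ℝ) : ℂ) =
      ∫ p : Rn d × Rn d, (∫ ω, B p.1 ω * B p.2 ω ∂P) * (D p.1 * D p.2) := by
  rw [← integral_complex_ofReal]
  have h1 : ∀ ω, ((b ω ^ 2 : ℝ) : ℂ) =
      ∫ p : Rn d × Rn d, (B p.1 ω * B p.2 ω) * (D p.1 * D p.2) := by
    intro ω
    push_cast
    rw [hb, sq, ← integral_prod_mul]
    exact integral_congr_ae (Eventually.of_forall fun p => by ring)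
  simp only [h1, ← integral_mul_const]
  rw [integral_integral_swap]
  have hDD : Integrable (fun q : Ω × (Rn d × Rn d) => D q.2.1 * D q.2.2)
      (P.prod (volume.prod volume)) := (hD.mul_prod hD).comp_snd P
  refine hDD.bdd_mul (c := M * M)
    (f := fun q : Ω × (Rn d × Rn d) => B q.2.1 q.1 * B q.2.2 q.1) ?_ ?_
  · exact ((hB.comp (by fun_prop : Measurable fun q : Ω × (Rn d × Rn d) => (q.2.1, q.1))).mul
      (hB.comp (by fun_prop : Measurable
        fun q : Ω × (Rn d × Rn d) => (q.2.2, q.1)))).aestronglyMeasurable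
  · refine Eventually.of_forall fun q => ?_
    rw [norm_mul]
    exact mul_le_mul (hBM _ _) (hBM _ _) (norm_nonneg _) ((norm_nonneg _).trans (hBM q.2.1 q.1))

lemma integral_superposition {M : ℝ} (hB : Measurable (Function.uncurry B))
    (hBM : ∀ ξ ω, ‖B ξ ω‖ ≤ M) {D : Rn d → ℂ} (hD : Integrable D) {b : Ω → ℝ}
    (hb : ∀ ω, (b ω : ℂ) = ∫ ξ, B ξ ω * D ξ) :
    ((∫ ω, b ω ∂P : ℝ) : ℂ) = ∫ ξ, (∫ ω, B ξ ω ∂P) * D ξ := by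
  rw [← integral_complex_ofReal]
  simp only [hb, ← integral_mul_const]
  rw [integral_integral_swap]
  refine (hD.comp_snd P).bdd_mul (c := M) (f := fun q : Ω × Rn d => B q.2 q.1) ?_ ?_
  · exact (hB.comp measurable_swap).aestronglyMeasurable
  · exact Eventually.of_forall fun q => hBM _ _

lemma measurable_integral_mul_family (hB : Measurable (Function.uncurry B)) :
    Measurable fun p : Rn d × Rn d => ∫ ω, B p.1 ω * B p.2 ω ∂P := by
  have hm : Measurable fun q : (Rn d × Rn d) × Ω => B q.1.1 q.2 * B q.1.2 q.2 :=
    (hB.comp (by fun_prop : Measurable fun q : (Rn d × Rn d) × Ω => (q.1.1, q.2))).mul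
      (hB.comp (by fun_prop : Measurable fun q : (Rn d × Rn d) × Ω => (q.1.2, q.2)))
  exact (hm.stronglyMeasurable.integral_prod_right').measurable

/-- If the second moments of `B` are integrable in frequency, the superpositions `a ε` are Cauchy
in `L²` as `ε` decreases to zero. -/
lemma tendsto_integral_sq_sub (hh : IsFourierProfile f h) {M : ℝ}
    (hB : Measurable (Function.uncurry B)) (hBM : ∀ ξ ω, ‖B ξ ω‖ ≤ M)
    (ha : ∀ ε, 0 < ε → ∀ ω, (a ε ω : ℂ) = ∫ ξ, B ξ ω * h (ε • ξ))
    (hK : Integrable fun p : Rn d × Rn d => ∫ ω, B p.1 ω * B p.2 ω ∂P) :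
    Tendsto (fun e : ℝ × ℝ => ∫ ω, (a e.1 ω - a e.2 ω) ^ 2 ∂P) (𝓝[>] 0 ×ˢ 𝓝[>] 0) (𝓝 0) := by
  obtain ⟨N, hN, hb⟩ := hh.bounded
  have hpos : ∀ᶠ e : ℝ × ℝ in 𝓝[>] 0 ×ˢ 𝓝[>] 0, 0 < e.1 ∧ 0 < e.2 :=
    (eventually_mem_nhdsWithin (a := (0 : ℝ)) (s := Set.Ioi 0)).prod_mk
      (eventually_mem_nhdsWithin (a := (0 : ℝ)) (s := Set.Ioi 0))
  -- The difference of two approximations is a superposition with weight `h(e.1 ξ) - h(e.2 ξ)`,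
  -- bounded by `2N` and tending to `h 0 - h 0 = 0` pointwise.
  have hlim : Tendsto (fun e : ℝ × ℝ => ∫ p : Rn d × Rn d, (∫ ω, B p.1 ω * B p.2 ω ∂P) *
      ((h (e.1 • p.1) - h (e.2 • p.1)) * (h (e.1 • p.2) - h (e.2 • p.2))))
      (𝓝[>] 0 ×ˢ 𝓝[>] 0) (𝓝 (∫ p : Rn d × Rn d, (∫ ω, B p.1 ω * B p.2 ω ∂P) *
        ((h 0 - h 0) * (h 0 - h 0)))) := by
    have hd : ∀ (e : ℝ × ℝ) (ξ : Rn d), ‖h (e.1 • ξ) - h (e.2 • ξ)‖ ≤ 2 * N := fun e ξ =>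
      (norm_sub_le _ _).trans (by linarith [hb (e.1 • ξ), hb (e.2 • ξ)])
    refine tendsto_integral_filter_of_dominated_convergence
      (fun p => ‖∫ ω, B p.1 ω * B p.2 ω ∂P‖ * ((2 * N) * (2 * N))) ?_ ?_ ?_ ?_
    · refine Eventually.of_forall fun e => hK.aestronglyMeasurable.mul ?_
      refine Continuous.aestronglyMeasurable ?_
      have h1 : Continuous fun ξ => h (e.1 • ξ) - h (e.2 • ξ) :=
        (hh.continuous_smul e.1).sub (hh.continuous_smul e.2)
      exact (h1.comp continuous_fst).mul (h1.comp continuous_snd)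
    · refine Eventually.of_forall fun e => Eventually.of_forall fun p => ?_
      rw [norm_mul, norm_mul]
      gcongr
      · exact hd e p.1
      · exact hd e p.2
    · exact hK.norm.mul_const _
    · refine Eventually.of_forall fun p => Tendsto.const_mul _ ?_
      exact (((hh.tendsto_smul p.1).comp tendsto_fst).sub
          ((hh.tendsto_smul p.1).comp tendsto_snd)).mul
        (((hh.tendsto_smul p.2).comp tendsto_fst).sub ((hh.tendsto_smul p.2).comp tendsto_snd))
  simp only [sub_self, mul_zero, integral_zero] at hlim
  have hre := (Complex.continuous_re.tendsto _).comp hlim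
  refine hre.congr' ?_
  filter_upwards [hpos] with e he
  have hi : ∀ {ε : ℝ}, 0 < ε → Integrable fun ξ : Rn d => h (ε • ξ) := fun hε =>
    hh.integrable.comp_smul hε.ne'
  have := integral_sq_superposition (P := P) hB hBM (D := fun ξ => h (e.1 • ξ) - h (e.2 • ξ))
    ((hi he.1).sub (hi he.2)) (b := fun ω => a e.1 ω - a e.2 ω) (fun ω => by
      have hi' : ∀ {ε : ℝ}, 0 < ε → Integrable fun ξ : Rn d => B ξ ω * h (ε • ξ) := fun hε =>
        (hi hε).bdd_mul (c := M) (hB.comp measurable_prodMk_right).aestronglyMeasurable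
          (Eventually.of_forall fun ξ => hBM ξ ω)
      push_cast
      rw [ha _ he.1, ha _ he.2, ← integral_sub (hi' he.1) (hi' he.2)]
      exact integral_congr_ae (Eventually.of_forall fun ξ => by ring))
  simp only [Function.comp_apply]
  rw [← this, Complex.ofReal_re]

/-- `L²` is complete, and on a probability space the `L¹` norm is at most the `L²` norm. -/
lemma exists_L1_limit_of_integral_sq_sub (ham : ∀ ε, MemLp (a ε) 2 P)
    (hcau : Tendsto (fun e : ℝ × ℝ => ∫ ω, (a e.1 ω - a e.2 ω) ^ 2 ∂P)
      (𝓝[>] 0 ×ˢ 𝓝[>] 0) (𝓝 0)) :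
    ∃ α : Ω → ℝ, Integrable α P ∧
      Tendsto (fun ε => eLpNorm (fun ω => a ε ω - α ω) 1 P) (𝓝[>] 0) (𝓝 0) := by
  let F : ℝ → Lp ℝ 2 P := fun ε => (ham ε).toLp
  have hnorm : ∀ e : ℝ × ℝ, dist (F e.1) (F e.2) =
      (∫ ω, (a e.1 ω - a e.2 ω) ^ 2 ∂P) ^ ((1 : ℝ) / 2) := by
    intro e
    rw [dist_eq_norm, ← MemLp.toLp_sub, Lp.norm_toLp,
      ((ham e.1).sub (ham e.2)).eLpNorm_eq_integral_rpow_norm (by norm_num) (by norm_num),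
      ENNReal.toReal_ofReal (by positivity)]
    simp
  have hC : Cauchy (map F (𝓝[>] 0)) := by
    rw [cauchy_map_iff]
    refine ⟨inferInstance, ?_⟩
    rw [Metric.uniformity_eq_comap_nhds_zero, tendsto_comap_iff]
    have := (hcau.rpow_const (p := (1 : ℝ) / 2) (Or.inr (by norm_num)))
    rw [Real.zero_rpow (by norm_num)] at this
    refine this.congr fun e => ?_
    exact (hnorm e).symm
  obtain ⟨G, hG⟩ := cauchy_map_iff_exists_tendsto.1 hC
  refine ⟨G, (Lp.memLp G).integrable (by norm_num), ?_⟩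
  rw [Lp.tendsto_Lp_iff_tendsto_eLpNorm'] at hG
  refine tendsto_of_tendsto_of_tendsto_of_le_of_le tendsto_const_nhds hG (fun _ => zero_le) ?_
  intro ε
  have h1 : eLpNorm (fun ω => a ε ω - G ω) 1 P ≤ eLpNorm (fun ω => a ε ω - G ω) 2 P :=
    eLpNorm_le_eLpNorm_of_exponent_le (by norm_num)
      ((ham ε).aestronglyMeasurable.sub (Lp.aestronglyMeasurable G))
  refine h1.trans (le_of_eq (eLpNorm_congr_ae ?_))
  filter_upwards [(ham ε).coeFn_toLp] with ω hω
  simp [F, hω]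

/-- Dominated convergence in frequency; the factor `(2π)^{-d}` is `h 0`. -/
lemma tendsto_integral_superposition (hh : IsFourierProfile f h) {M : ℝ}
    (hB : Measurable (Function.uncurry B)) (hBM : ∀ ξ ω, ‖B ξ ω‖ ≤ M)
    (ha : ∀ ε, 0 < ε → ∀ ω, (a ε ω : ℂ) = ∫ ξ, B ξ ω * h (ε • ξ))
    (hK : Integrable fun ξ => ∫ ω, B ξ ω ∂P) :
    Tendsto (fun ε => ∫ ω, a ε ω ∂P) (𝓝[>] 0)
      (𝓝 (invTwoPi d * ∫ ξ, ∫ ω, B ξ ω ∂P : ℂ).re) := by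
  obtain ⟨N, hN, hb⟩ := hh.bounded
  have hlim : Tendsto (fun ε : ℝ => ∫ ξ, (∫ ω, B ξ ω ∂P) * h (ε • ξ)) (𝓝[>] 0)
      (𝓝 (∫ ξ, (∫ ω, B ξ ω ∂P) * h 0)) := by
    refine tendsto_integral_filter_of_dominated_convergence
      (fun ξ => ‖∫ ω, B ξ ω ∂P‖ * N) ?_ ?_ (hK.norm.mul_const _) ?_
    · exact Eventually.of_forall fun ε => hK.aestronglyMeasurable.mul
        (hh.continuous_smul ε).aestronglyMeasurable
    · refine Eventually.of_forall fun e => Eventually.of_forall fun p => ?_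
      rw [norm_mul]
      gcongr
      exact hb _
    · exact Eventually.of_forall fun ξ => Tendsto.const_mul _ (hh.tendsto_smul ξ)
  rw [integral_mul_const, hh.zero, mul_comm] at hlim
  refine ((Complex.continuous_re.tendsto _).comp hlim).congr' ?_
  filter_upwards [self_mem_nhdsWithin] with ε hε
  have hε : 0 < ε := hε
  simp only [Function.comp_apply]
  rw [← integral_superposition hB hBM (hh.integrable.comp_smul hε.ne') (ha ε hε),
    Complex.ofReal_re]

end FourierSuperposition

/-! ### Jointly measurable versions of the processes -/

section MeasurableVersion

variable {d : ℕ} {Ω : Type*} [MeasurableSpace Ω]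

/-- A process with right-continuous paths is jointly measurable. -/
lemma measurable_uncurry_of_rightContinuous {Y : ℝ≥0 → Ω → Rn d} (hY : ∀ r, Measurable (Y r))
    (hc : ∀ ω r, ContinuousWithinAt (fun r => Y r ω) (Set.Ici r) r) :
    Measurable (Function.uncurry Y) := by
  -- The next point of the grid of mesh `1/(n+1)` to the right of `r`. It takes countably many
  -- values, so `Y (g n r) ω` is jointly measurable.
  let g : ℕ → ℝ≥0 → ℝ≥0 := fun n r => ((⌊((n : ℝ≥0) + 1) * r⌋₊ : ℝ≥0) + 1) / ((n : ℝ≥0) + 1)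
  have hg1 : ∀ n r, r ≤ g n r := by
    intro n r
    rw [le_div_iff₀ (by positivity), mul_comm]
    exact (Nat.lt_floor_add_one _).le
  have hg2 : ∀ n r, g n r ≤ r + 1 / ((n : ℝ≥0) + 1) := by
    intro n r
    have hn : (0 : ℝ≥0) < (n : ℝ≥0) + 1 := by positivity
    have h1 : (r + 1 / ((n : ℝ≥0) + 1)) * ((n : ℝ≥0) + 1) = ((n : ℝ≥0) + 1) * r + 1 := by
      field_simp
    rw [div_le_iff₀ hn, h1]
    gcongr
    exact Nat.floor_le (by positivity)
  have hg : ∀ r, Tendsto (fun n => g n r) atTop (𝓝[≥] r) := by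
    intro r
    refine tendsto_nhdsWithin_iff.2 ⟨?_, Eventually.of_forall fun n => hg1 n r⟩
    refine tendsto_of_tendsto_of_tendsto_of_le_of_le tendsto_const_nhds ?_
      (fun n => hg1 n r) (fun n => hg2 n r)
    have : Tendsto (fun n : ℕ => r + 1 / ((n : ℝ≥0) + 1)) atTop (𝓝 (r + 0)) :=
      tendsto_const_nhds.add (tendsto_one_div_add_atTop_nhds_zero_nat (𝕜 := ℝ≥0))
    rwa [add_zero] at this
  refine measurable_of_tendsto_metrizable (f := fun (n : ℕ) (p : ℝ≥0 × Ω) => Y (g n p.1) p.2) ?_ ?_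
  · intro n
    have h1 : Measurable fun q : ℕ × Ω => Y (((q.1 : ℝ≥0) + 1) / ((n : ℝ≥0) + 1)) q.2 :=
      measurable_from_prod_countable_right fun k => hY (((k : ℝ≥0) + 1) / ((n : ℝ≥0) + 1))
    have h2 : Measurable fun p : ℝ≥0 × Ω => (⌊((n : ℝ≥0) + 1) * p.1⌋₊, p.2) :=
      ((Nat.measurable_floor.comp (measurable_const.mul measurable_fst))).prodMk measurable_snd
    have h3 := h1.comp h2
    exact h3
  · refine tendsto_pi_nhds.2 fun p => ?_
    exact (hc p.2 p.1).tendsto.comp (hg p.1)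

lemma IsSymmetricStableProcess.congr {P : Measure Ω} {β : ℝ} {ψ : Rn d → ℝ} {x : Rn d}
    {X Y : ℝ≥0 → Ω → Rn d} (hX : IsSymmetricStableProcess P β ψ x X)
    (hY : ∀ r, Measurable (Y r)) (h : ∀ᵐ ω ∂P, ∀ r, Y r ω = X r ω) :
    IsSymmetricStableProcess P β ψ x Y where
  exponent := hX.exponent
  measurable := hY
  start := by
    filter_upwards [hX.start, h] with ω h1 h2
    rw [h2, h1]
  indep_increments n t ht := by
    refine (hX.indep_increments n t ht).congr fun i => ?_
    filter_upwards [h] with ω hω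
    rw [hω, hω]
  charFun_increment r k ξ := by
    rw [← hX.charFun_increment r k ξ]
    congr 1
    refine Measure.map_congr ?_
    filter_upwards [h] with ω hω
    rw [hω, hω]
  cadlag := by
    filter_upwards [hX.cadlag, h] with ω h1 h2
    rwa [show (fun t => Y t ω) = fun t => X t ω from funext h2]

/-- Paths are càdlàg only almost surely. Setting them to zero on a measurable null set makes every
path right continuous, hence the process jointly measurable, as Fubini in time requires. -/
lemma IsSymmetricStableProcess.exists_measurable_version {P : Measure Ω} {β : ℝ} {ψ : Rn d → ℝ}
    {x : Rn d} {X : ℝ≥0 → Ω → Rn d} (hX : IsSymmetricStableProcess P β ψ x X) :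
    ∃ Y : ℝ≥0 → Ω → Rn d, Measurable (Function.uncurry Y) ∧ (∀ᵐ ω ∂P, ∀ r, Y r ω = X r ω) ∧
      IsSymmetricStableProcess P β ψ x Y := by
  classical
  -- The set of bad paths need not be measurable, so a measurable null set containing it is used.
  let N := toMeasurable P {ω | ¬ IsCadlagPath (fun t => X t ω)}
  have hN : MeasurableSet N := measurableSet_toMeasurable _ _
  have hN0 : P N = 0 := by rw [measure_toMeasurable]; exact hX.cadlag
  have hm : ∀ r, Measurable fun ω => if ω ∈ N then 0 else X r ω := fun r =>
    Measurable.ite hN measurable_const (hX.measurable r)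
  have hae : ∀ᵐ ω ∂P, ∀ r, (if ω ∈ N then 0 else X r ω) = X r ω := by
    filter_upwards [measure_eq_zero_iff_ae_notMem.1 hN0] with ω hω r
    simp [hω]
  refine ⟨fun r ω => if ω ∈ N then 0 else X r ω, ?_, hae, hX.congr hm hae⟩
  refine measurable_uncurry_of_rightContinuous hm fun ω r => ?_
  by_cases h : ω ∈ N
  · simp only [h, if_true]; exact continuousWithinAt_const
  · simp only [h, if_false]
    have : IsCadlagPath (fun t => X t ω) := by
      by_contra h'
      exact h (subset_toMeasurable _ _ h')
    exact (this r).1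

end MeasurableVersion

@[fun_prop]
lemma measurable_ch_comp {d : ℕ} {Ω : Type*} [MeasurableSpace Ω] {ζ Z : Ω → Rn d}
    (hζ : Measurable ζ) (hZ : Measurable Z) : Measurable fun ω => ch (ζ ω) (Z ω) := by
  unfold ch; fun_prop

/-! ### One- and two-time characters of stable processes -/

section Moments

variable {d : ℕ} {Ω : Type*} [MeasurableSpace Ω] {P : Measure Ω}
  {β : ℝ} {ψ : Rn d → ℝ} {x : Rn d} {X X' : ℝ≥0 → Ω → Rn d}

lemma IsSymmetricStableProcess.integral_ch_sub (hX : IsSymmetricStableProcess P β ψ x X)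
    {r r' : ℝ≥0} (h : r ≤ r') (ξ : Rn d) :
    ∫ ω, ch ξ (X r' ω - X r ω) ∂P = (Real.exp (-((r' : ℝ) - r) * ψ ξ) : ℝ) := by
  have hm := hX.measurable
  have := hX.charFun_increment r (r' - r) ξ
  rw [add_tsub_cancel_of_le h, charFun_eq_integral_ch, integral_map
    (by fun_prop) (by fun_prop), NNReal.coe_sub h] at this
  exact this

lemma IsSymmetricStableProcess.integral_ch (hX : IsSymmetricStableProcess P β ψ x X)
    (r : ℝ≥0) (ξ : Rn d) :
    ∫ ω, ch ξ (X r ω) ∂P = ch ξ x * (Real.exp (-(r : ℝ) * ψ ξ) : ℝ) := by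
  have h := hX.integral_ch_sub (zero_le : 0 ≤ r) ξ
  rw [NNReal.coe_zero, sub_zero] at h
  rw [← h, ← integral_const_mul]
  refine integral_congr_ae ?_
  filter_upwards [hX.start] with ω hω
  rw [← ch_add_right, hω, add_sub_cancel]

/-- Regroup `⟨X_r,ξ⟩ + ⟨X_{r'},η⟩` as `⟨X_r,ξ+η⟩ + ⟨X_{r'}-X_r,η⟩` and use independent increments.
The starting point contributes only a phase, lost in the norm. -/
lemma IsSymmetricStableProcess.norm_integral_ch_mul (hX : IsSymmetricStableProcess P β ψ x X)
    {r r' : ℝ≥0} (h : r ≤ r') (ξ η : Rn d) :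
    ‖∫ ω, ch ξ (X r ω) * ch η (X r' ω) ∂P‖ =
      Real.exp (-(r : ℝ) * ψ (ξ + η)) * Real.exp (-((r' : ℝ) - r) * ψ η) := by
  have h1 : ∫ ω, ch ξ (X r ω) * ch η (X r' ω) ∂P =
      ∫ ω, ch (ξ + η) x * (ch (ξ + η) (X r ω - X 0 ω) * ch η (X r' ω - X r ω)) ∂P := by
    refine integral_congr_ae ?_
    filter_upwards [hX.start] with ω hω
    rw [← mul_assoc, ← ch_add_right, hω, add_sub_cancel, ch_add_left, mul_assoc, ← ch_add_right,
      add_sub_cancel]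
  have hm := hX.measurable
  have hind := (hX.indep_increments.indepFun_sub_sub (zero_le : 0 ≤ r) h).comp
    (φ := ch (ξ + η)) (ψ := ch η) (by fun_prop) (by fun_prop)
  have h2 := hind.integral_fun_mul_eq_mul_integral
    (Measurable.aestronglyMeasurable (by fun_prop)) (Measurable.aestronglyMeasurable (by fun_prop))
  simp only [Function.comp_apply, Pi.sub_apply] at h2
  rw [h1, integral_const_mul, h2, hX.integral_ch_sub zero_le, hX.integral_ch_sub h]
  simp [Complex.norm_exp]

lemma integral_ch_sub_of_indepFun (hX : ∀ r, Measurable (X r)) (hX' : ∀ r, Measurable (X' r))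
    (hindep : IndepFun (fun ω r => X r ω) (fun ω r => X' r ω) P) (r u : ℝ≥0) (ξ : Rn d) :
    ∫ ω, ch ξ (X r ω - X' u ω) ∂P = (∫ ω, ch ξ (X r ω) ∂P) * ∫ ω, ch (-ξ) (X' u ω) ∂P := by
  have hind := hindep.comp (φ := fun w : ℝ≥0 → Rn d => ch ξ (w r))
    (ψ := fun w : ℝ≥0 → Rn d => ch (-ξ) (w u))
    (by fun_prop) (by fun_prop)
  have h2 := hind.integral_fun_mul_eq_mul_integral
    (Measurable.aestronglyMeasurable (by fun_prop)) (Measurable.aestronglyMeasurable (by fun_prop))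
  simp only [Function.comp_apply] at h2
  simp only [ch_sub_right, h2]

lemma integral_ch_sub_mul_of_indepFun (hX : ∀ r, Measurable (X r))
    (hX' : ∀ r, Measurable (X' r))
    (hindep : IndepFun (fun ω r => X r ω) (fun ω r => X' r ω) P) (r u r' u' : ℝ≥0) (ξ η : Rn d) :
    ∫ ω, ch ξ (X r ω - X' u ω) * ch η (X r' ω - X' u' ω) ∂P =
      (∫ ω, ch ξ (X r ω) * ch η (X r' ω) ∂P) *
        ∫ ω, ch (-ξ) (X' u ω) * ch (-η) (X' u' ω) ∂P := by
  have hind := hindep.comp (φ := fun w : ℝ≥0 → Rn d => ch ξ (w r) * ch η (w r'))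
    (ψ := fun w : ℝ≥0 → Rn d => ch (-ξ) (w u) * ch (-η) (w u'))
    (by fun_prop) (by fun_prop)
  have h2 := hind.integral_fun_mul_eq_mul_integral
    (Measurable.aestronglyMeasurable (by fun_prop)) (Measurable.aestronglyMeasurable (by fun_prop))
  simp only [Function.comp_apply] at h2
  rw [← h2]
  congr 1; ext ω
  rw [ch_sub_right, ch_sub_right]; ring

end Moments

/-! ### Exponential kernels dominating the two-time characters -/

section ExponentialKernel

/-- The exponential `exp (-(1 + A) r)` cut off to `r ≥ 0`. -/
noncomputable def expTail (A r : ℝ) : ℝ≥0∞ :=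
  (Set.Ici 0).indicator (fun r => ENNReal.ofReal (Real.exp (-(1 + A) * r))) r

@[fun_prop]
lemma measurable_expTail (A : ℝ) : Measurable (expTail A) :=
  Measurable.indicator (by fun_prop) measurableSet_Ici

lemma expTail_of_nonneg (A : ℝ) {r : ℝ} (hr : 0 ≤ r) :
    expTail A r = ENNReal.ofReal (Real.exp (-(1 + A) * r)) :=
  Set.indicator_of_mem (Set.mem_Ici.2 hr) _

lemma lintegral_expTail {A : ℝ} (hA : 0 ≤ A) : ∫⁻ r, expTail A r = ENNReal.ofReal (1 + A)⁻¹ := by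
  have hneg : -(1 + A) < 0 := by linarith
  simp only [expTail]
  rw [lintegral_indicator measurableSet_Ici, setLIntegral_congr Ioi_ae_eq_Ici.symm,
    ← ofReal_integral_eq_lintegral_ofReal (integrableOn_exp_mul_Ioi hneg 0)
      (Eventually.of_forall fun r => (Real.exp_pos _).le), integral_exp_mul_Ioi hneg]
  rw [mul_zero, Real.exp_zero, neg_div_neg_eq, one_div]

/-- A kernel dominating the two-time characters of a stable process. -/
noncomputable def pairKernel (A B C : ℝ) (r r' : ℝ) : ℝ≥0∞ :=
  expTail A r * expTail B (r' - r) + expTail A r' * expTail C (r - r')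

lemma measurable_pairKernel (A B C : ℝ) :
    Measurable (Function.uncurry (pairKernel A B C)) := by
  simp only [Function.uncurry_def, pairKernel]; fun_prop

lemma lintegral_pairKernel {A B C : ℝ} (hA : 0 ≤ A) (hB : 0 ≤ B) (hC : 0 ≤ C) :
    ∫⁻ r, ∫⁻ r', pairKernel A B C r r' =
      ENNReal.ofReal ((1 + A)⁻¹ * ((1 + B)⁻¹ + (1 + C)⁻¹)) := by
  have h1 : ∀ {D : ℝ}, 0 ≤ D → ∫⁻ r, ∫⁻ r', expTail A r * expTail D (r' - r) =
      ENNReal.ofReal ((1 + A)⁻¹ * (1 + D)⁻¹) := by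
    intro D hD
    have : ∀ r, ∫⁻ r', expTail A r * expTail D (r' - r) =
        expTail A r * ENNReal.ofReal (1 + D)⁻¹ := fun r => by
      rw [lintegral_const_mul _ (by fun_prop), lintegral_sub_right_eq_self (expTail D),
        lintegral_expTail hD]
    simp only [this]
    rw [lintegral_mul_const _ (by fun_prop), lintegral_expTail hA, ENNReal.ofReal_mul (by positivity)]
  have h2 : ∫⁻ r, ∫⁻ r', expTail A r' * expTail C (r - r') =
      ENNReal.ofReal ((1 + A)⁻¹ * (1 + C)⁻¹) := by
    rw [lintegral_lintegral_swap (by fun_prop)]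
    exact h1 hC
  simp only [pairKernel]
  have h3 : ∀ r, ∫⁻ r', (expTail A r * expTail B (r' - r) + expTail A r' * expTail C (r - r')) =
      (∫⁻ r', expTail A r * expTail B (r' - r)) + ∫⁻ r', expTail A r' * expTail C (r - r') :=
    fun r => lintegral_add_left (by fun_prop) _
  simp only [h3]
  rw [lintegral_add_left (Measurable.lintegral_prod_right' (f := fun p : ℝ × ℝ =>
    expTail A p.1 * expTail B (p.2 - p.1)) (by fun_prop)), h1 hB, h2, mul_add,
    ENNReal.ofReal_add (by positivity) (by positivity)]

variable {d : ℕ} {Ω : Type*} [MeasurableSpace Ω] {P : Measure Ω}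
  {β : ℝ} {ψ : Rn d → ℝ} {x : Rn d} {Y : ℝ≥0 → Ω → Rn d}

/-- The two summands of the kernel cover the two orders of `r` and `r'`. Replacing each rate `a` by
`1 + a` costs a factor `e^{max(r,r')} ≤ e^s` and makes the kernel integrable over the whole line
even where `ψ` vanishes. -/
lemma IsSymmetricStableProcess.enorm_integral_ch_mul_le
    (hY : IsSymmetricStableProcess P β ψ x Y) {s r r' : ℝ} (hr : r ∈ Set.Ioc 0 s)
    (hr' : r' ∈ Set.Ioc 0 s) (ξ η : Rn d) :
    ‖∫ ω, ch ξ (Y r.toNNReal ω) * ch η (Y r'.toNNReal ω) ∂P‖ₑ ≤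
      ENNReal.ofReal (Real.exp s) * pairKernel (ψ (ξ + η)) (ψ η) (ψ ξ) r r' := by
  have key : ∀ {r r' : ℝ}, r ∈ Set.Ioc 0 s → r' ∈ Set.Ioc 0 s → r ≤ r' → ∀ ξ η : Rn d,
      ‖∫ ω, ch ξ (Y r.toNNReal ω) * ch η (Y r'.toNNReal ω) ∂P‖ₑ ≤
      ENNReal.ofReal (Real.exp s) * (expTail (ψ (ξ + η)) r * expTail (ψ η) (r' - r)) := by
    intro r r' hr hr' hle ξ η
    rw [← ofReal_norm, hY.norm_integral_ch_mul (Real.toNNReal_le_toNNReal hle),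
      Real.coe_toNNReal _ hr.1.le, Real.coe_toNNReal _ hr'.1.le, expTail_of_nonneg _ hr.1.le,
      expTail_of_nonneg _ (sub_nonneg.2 hle), ← ENNReal.ofReal_mul (Real.exp_pos _).le,
      ← ENNReal.ofReal_mul (Real.exp_pos _).le, ← Real.exp_add, ← Real.exp_add, ← Real.exp_add]
    refine ENNReal.ofReal_le_ofReal (Real.exp_le_exp.2 ?_)
    have := hr'.2
    linarith
  rcases le_total r r' with h | h
  · refine (key hr hr' h ξ η).trans ?_
    gcongr
    exact le_self_add
  · have h1 := key hr' hr h η ξ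
    rw [add_comm η ξ] at h1
    simp only [mul_comm (ch η _)] at h1
    refine h1.trans ?_
    gcongr
    exact le_add_self

end ExponentialKernel

/-! ### The occupation Fourier transform -/

section OccupationFourier

variable {d : ℕ} {Ω : Type*} [MeasurableSpace Ω]

/-- Lebesgue measure on `(0, s] × (0, t]`. -/
noncomputable def timeBox (s t : ℝ) : Measure (ℝ × ℝ) :=
  (volume.restrict (Set.Ioc 0 s)).prod (volume.restrict (Set.Ioc 0 t))

instance (s t : ℝ) : IsFiniteMeasure (timeBox s t) := by unfold timeBox; infer_instance

lemma ae_mem_timeBox (s t : ℝ) :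
    ∀ᵐ τ ∂timeBox s t, τ.1 ∈ Set.Ioc 0 s ∧ τ.2 ∈ Set.Ioc 0 t := by
  rw [timeBox, Measure.prod_restrict]
  exact ae_restrict_mem (measurableSet_Ioc.prod measurableSet_Ioc)

/-- The difference `Y_r - Y'_u` at the pair of times `(r, u)`. -/
noncomputable def pairDiff (Y Y' : ℝ≥0 → Ω → Rn d) (τ : ℝ × ℝ) (ω : Ω) : Rn d :=
  Y τ.1.toNNReal ω - Y' τ.2.toNNReal ω

/-- The Fourier transform of the occupation measure of `(r, u) ↦ Y_r - Y'_u`. -/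
noncomputable def occupationFourier (Y Y' : ℝ≥0 → Ω → Rn d) (s t : ℝ) (ξ : Rn d) (ω : Ω) : ℂ :=
  ∫ τ, ch ξ (pairDiff Y Y' τ ω) ∂timeBox s t

variable {Y Y' : ℝ≥0 → Ω → Rn d}

lemma measurable_pairDiff (hY : Measurable (Function.uncurry Y))
    (hY' : Measurable (Function.uncurry Y')) :
    Measurable fun q : (ℝ × ℝ) × Ω => pairDiff Y Y' q.1 q.2 := by
  have h1 : Measurable fun q : (ℝ × ℝ) × Ω => Y q.1.1.toNNReal q.2 :=
    hY.comp (by fun_prop : Measurable fun q : (ℝ × ℝ) × Ω => (q.1.1.toNNReal, q.2))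
  have h2 : Measurable fun q : (ℝ × ℝ) × Ω => Y' q.1.2.toNNReal q.2 :=
    hY'.comp (by fun_prop : Measurable fun q : (ℝ × ℝ) × Ω => (q.1.2.toNNReal, q.2))
  exact h1.sub h2

@[fun_prop]
lemma measurable_pairDiff_comp {S : Type*} [MeasurableSpace S] (hY : Measurable (Function.uncurry Y))
    (hY' : Measurable (Function.uncurry Y')) {τ : S → ℝ × ℝ} {ω : S → Ω} (hτ : Measurable τ)
    (hω : Measurable ω) : Measurable fun z => pairDiff Y Y' (τ z) (ω z) := by
  have h := (measurable_pairDiff hY hY').comp (hτ.prodMk hω)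
  exact h

lemma measurable_occupationFourier (hY : Measurable (Function.uncurry Y))
    (hY' : Measurable (Function.uncurry Y')) (s t : ℝ) :
    Measurable (Function.uncurry (occupationFourier Y Y' s t)) := by
  have : Measurable fun q : (Rn d × Ω) × (ℝ × ℝ) => ch q.1.1 (pairDiff Y Y' q.2 q.1.2) := by
    fun_prop
  exact this.stronglyMeasurable.integral_prod_right'.measurable

omit [MeasurableSpace Ω] in
lemma norm_occupationFourier_le (s t : ℝ) (ξ : Rn d) (ω : Ω) :
    ‖occupationFourier Y Y' s t ξ ω‖ ≤ (timeBox s t).real Set.univ := by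
  refine (norm_integral_le_of_norm_le_const (C := 1) (by simp)).trans (by simp)

lemma integral_approxDelta_pairDiff {f : SchwartzMap (Rn d) ℝ} {h : Rn d → ℂ}
    (hh : IsFourierProfile f h) (hY : Measurable (Function.uncurry Y))
    (hY' : Measurable (Function.uncurry Y')) (s t : ℝ) {ε : ℝ} (hε : 0 < ε) (ω : Ω) :
    ((∫ τ, approxDelta f ε (pairDiff Y Y' τ ω) ∂timeBox s t : ℝ) : ℂ) =
      ∫ ξ, occupationFourier Y Y' s t ξ ω * h (ε • ξ) := by
  rw [← integral_complex_ofReal]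
  simp only [hh.repr ε hε, occupationFourier, ← integral_mul_const]
  rw [integral_integral_swap]
  refine ((hh.integrable.comp_smul hε.ne').comp_snd (timeBox s t)).bdd_mul (c := 1)
    (f := fun q : (ℝ × ℝ) × Rn d => ch q.2 (pairDiff Y Y' q.1 ω)) ?_ (by simp)
  exact Measurable.aestronglyMeasurable (by fun_prop)

lemma memLp_integral_approxDelta {P : Measure Ω} [IsProbabilityMeasure P]
    (f : SchwartzMap (Rn d) ℝ) (hY : Measurable (Function.uncurry Y))
    (hY' : Measurable (Function.uncurry Y')) (s t ε : ℝ) :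
    MemLp (fun ω => ∫ τ, approxDelta f ε (pairDiff Y Y' τ ω) ∂timeBox s t) 2 P := by
  obtain ⟨M, -, hM⟩ := approxDelta_bounded f ε
  refine MemLp.of_bound (C := M * (timeBox s t).real Set.univ) ?_
    (Eventually.of_forall fun ω => norm_integral_le_of_norm_le_const
      (Eventually.of_forall fun τ => hM _))
  have hm := (continuous_approxDelta f ε).measurable
  have : Measurable fun q : Ω × (ℝ × ℝ) => approxDelta f ε (pairDiff Y Y' q.2 q.1) := by
    fun_prop
  exact this.stronglyMeasurable.integral_prod_right'.aestronglyMeasurable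

lemma approxIntersectionLocalTime_eq_integral_timeBox (f : SchwartzMap (Rn d) ℝ)
    (hY : Measurable (Function.uncurry Y)) (hY' : Measurable (Function.uncurry Y')) {s t : ℝ}
    (hs : 0 ≤ s) (ht : 0 ≤ t) (ε : ℝ) {X X' : ℝ≥0 → Ω → Rn d} {ω : Ω}
    (h : ∀ r, Y r ω = X r ω) (h' : ∀ r, Y' r ω = X' r ω) :
    approxIntersectionLocalTime f X X' s t ε ω =
      ∫ τ, approxDelta f ε (pairDiff Y Y' τ ω) ∂timeBox s t := by
  obtain ⟨M, -, hM⟩ := approxDelta_bounded f ε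
  have hm := (continuous_approxDelta f ε).measurable
  have : Measurable fun τ : ℝ × ℝ => approxDelta f ε (pairDiff Y Y' τ ω) := by fun_prop
  have hi : Integrable (fun τ : ℝ × ℝ => approxDelta f ε (pairDiff Y Y' τ ω)) (timeBox s t) :=
    Integrable.of_bound this.aestronglyMeasurable M (Eventually.of_forall fun τ => hM _)
  rw [timeBox, integral_prod _ hi, approxIntersectionLocalTime,
    intervalIntegral.integral_of_le hs]
  simp only [intervalIntegral.integral_of_le ht, pairDiff, h, h']

end OccupationFourier

/-! ### First and second moments of the occupation Fourier transform -/

section OccupationMoments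

variable {d : ℕ} {Ω : Type*} [MeasurableSpace Ω] {P : Measure Ω} [IsProbabilityMeasure P]
  {β : ℝ} {ψ : Rn d → ℝ} {x y : Rn d} {Y Y' : ℝ≥0 → Ω → Rn d}

/-- Tonelli separates the times `(r,r')` of the first process from the times `(u,u')` of the second;
each range is then enlarged to the whole line. -/
lemma lintegral_timeBox_prod_le {W W' : ℝ → ℝ → ℝ≥0∞} (hW : Measurable (Function.uncurry W))
    (hW' : Measurable (Function.uncurry W')) (s t : ℝ) :
    ∫⁻ q : (ℝ × ℝ) × (ℝ × ℝ), W q.1.1 q.2.1 * W' q.1.2 q.2.2 ∂(timeBox s t).prod (timeBox s t) ≤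
      (∫⁻ r, ∫⁻ r', W r r') * ∫⁻ u, ∫⁻ u', W' u u' := by
  have hm : Measurable fun q : (ℝ × ℝ) × (ℝ × ℝ) => W q.1.1 q.2.1 * W' q.1.2 q.2.2 :=
    (hW.comp (by fun_prop : Measurable fun q : (ℝ × ℝ) × (ℝ × ℝ) => (q.1.1, q.2.1))).mul
      (hW'.comp (by fun_prop : Measurable fun q : (ℝ × ℝ) × (ℝ × ℝ) => (q.1.2, q.2.2)))
  have hs : ∀ {V : ℝ → ℝ → ℝ≥0∞}, Measurable (Function.uncurry V) → ∀ c : ℝ, Measurable fun r =>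
      ∫⁻ r', V r r' ∂(volume.restrict (Set.Ioc 0 c)) := fun hV c => hV.lintegral_prod_right'
  rw [lintegral_prod _ hm.aemeasurable]
  have h1 : ∀ τ : ℝ × ℝ, ∫⁻ τ' : ℝ × ℝ, W τ.1 τ'.1 * W' τ.2 τ'.2 ∂timeBox s t =
      (∫⁻ r' in Set.Ioc 0 s, W τ.1 r') * ∫⁻ u' in Set.Ioc 0 t, W' τ.2 u' := fun τ => by
    rw [timeBox]
    exact lintegral_prod_mul (hW.comp measurable_prodMk_left).aemeasurable
      (hW'.comp measurable_prodMk_left).aemeasurable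
  simp only [h1]
  rw [timeBox, lintegral_prod_mul (hs hW s).aemeasurable (hs hW' t).aemeasurable]
  gcongr
  all_goals exact Measure.restrict_le_self

lemma integral_occupationFourier_mul (hYm : Measurable (Function.uncurry Y))
    (hYm' : Measurable (Function.uncurry Y')) (s t : ℝ) (ξ η : Rn d) :
    ∫ ω, occupationFourier Y Y' s t ξ ω * occupationFourier Y Y' s t η ω ∂P =
      ∫ q : (ℝ × ℝ) × (ℝ × ℝ), (∫ ω, ch ξ (pairDiff Y Y' q.1 ω) * ch η (pairDiff Y Y' q.2 ω) ∂P)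
        ∂(timeBox s t).prod (timeBox s t) := by
  simp only [occupationFourier, ← integral_prod_mul]
  rw [integral_integral_swap]
  refine Integrable.of_bound (C := 1) (Measurable.aestronglyMeasurable ?_)
    (Eventually.of_forall fun q => by simp [Function.uncurry])
  simp only [Function.uncurry_def]
  fun_prop

/-- The second moments of the occupation Fourier transform decay in frequency. -/
lemma norm_integral_occupationFourier_mul_le (hY : IsSymmetricStableProcess P β ψ x Y)
    (hY' : IsSymmetricStableProcess P β ψ y Y') (hYm : Measurable (Function.uncurry Y))
    (hYm' : Measurable (Function.uncurry Y'))
    (hindep : IndepFun (fun ω r => Y r ω) (fun ω r => Y' r ω) P) (s t : ℝ) (ξ η : Rn d) :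
    ‖∫ ω, occupationFourier Y Y' s t ξ ω * occupationFourier Y Y' s t η ω ∂P‖ ≤
      Real.exp s * Real.exp t *
        (invOneAdd ψ (ξ + η) * (invOneAdd ψ η + invOneAdd ψ ξ)) ^ 2 := by
  have hg := fun ξ => (invOneAdd_pos hY.exponent ξ).le
  have hb : 0 ≤ invOneAdd ψ (ξ + η) * (invOneAdd ψ η + invOneAdd ψ ξ) :=
    mul_nonneg (hg _) (add_nonneg (hg _) (hg _))
  rw [← ENNReal.ofReal_le_ofReal_iff (by positivity), ofReal_norm,
    integral_occupationFourier_mul hYm hYm']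
  refine (enorm_integral_le_lintegral_enorm _).trans ?_
  have hev : ∀ ζ, ψ (-ζ) = ψ ζ := hY.exponent.even
  have hae : ∀ᵐ q : (ℝ × ℝ) × (ℝ × ℝ) ∂(timeBox s t).prod (timeBox s t),
      ‖∫ ω, ch ξ (pairDiff Y Y' q.1 ω) * ch η (pairDiff Y Y' q.2 ω) ∂P‖ₑ ≤
      (ENNReal.ofReal (Real.exp s) * ENNReal.ofReal (Real.exp t)) *
      (pairKernel (ψ (ξ + η)) (ψ η) (ψ ξ) q.1.1 q.2.1 *
        pairKernel (ψ (ξ + η)) (ψ η) (ψ ξ) q.1.2 q.2.2) := by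
    have h1 := (Measure.quasiMeasurePreserving_fst (μ := timeBox s t) (ν := timeBox s t)).ae
      (ae_mem_timeBox s t)
    have h2 := (Measure.quasiMeasurePreserving_snd (μ := timeBox s t) (ν := timeBox s t)).ae
      (ae_mem_timeBox s t)
    filter_upwards [h1, h2] with q hq1 hq2
    simp only [pairDiff]
    rw [integral_ch_sub_mul_of_indepFun hY.measurable hY'.measurable hindep, enorm_mul]
    refine (mul_le_mul' (hY.enorm_integral_ch_mul_le hq1.1 hq2.1 ξ η)
      (hY'.enorm_integral_ch_mul_le hq1.2 hq2.2 (-ξ) (-η))).trans (le_of_eq ?_)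
    -- The second process carries the frequencies `-ξ` and `-η`; evenness of `ψ` makes its kernel
    -- the same as the first.
    rw [← neg_add, hev, hev, hev]
    ring
  refine (lintegral_mono_ae hae).trans ?_
  rw [lintegral_const_mul' _ _ (ENNReal.mul_ne_top ENNReal.ofReal_ne_top ENNReal.ofReal_ne_top)]
  have hn := hY.exponent.nonneg
  have h3 := lintegral_timeBox_prod_le (measurable_pairKernel (ψ (ξ + η)) (ψ η) (ψ ξ))
    (measurable_pairKernel (ψ (ξ + η)) (ψ η) (ψ ξ)) s t
  simp only [lintegral_pairKernel (hn (ξ + η)) (hn η) (hn ξ)] at h3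
  rw [ENNReal.ofReal_mul (by positivity), ENNReal.ofReal_mul (by positivity), sq,
    ENNReal.ofReal_mul hb]
  exact mul_le_mul_right h3 _

/-- By `(a+b)² ≤ 2(a²+b²)` the moment bound splits into `g(ξ)² g(ξ+η)²` and its mirror image. The
measure-preserving shear `(ξ,η) ↦ (ξ,ξ+η)` turns each into a product of integrable functions. -/
lemma integrable_integral_occupationFourier_mul (hβ0 : 0 < β) (hβ : (d : ℝ) / 2 < β)
    (hY : IsSymmetricStableProcess P β ψ x Y)
    (hY' : IsSymmetricStableProcess P β ψ y Y') (hYm : Measurable (Function.uncurry Y))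
    (hYm' : Measurable (Function.uncurry Y'))
    (hindep : IndepFun (fun ω r => Y r ω) (fun ω r => Y' r ω) P) (s t : ℝ) :
    Integrable fun p : Rn d × Rn d =>
      ∫ ω, occupationFourier Y Y' s t p.1 ω * occupationFourier Y Y' s t p.2 ω ∂P := by
  set g := invOneAdd ψ with hgdef
  have hg2 := integrable_invOneAdd_sq hY.exponent hβ0 hβ
  have hG : Integrable fun p : Rn d × Rn d => g p.1 ^ 2 * g (p.1 + p.2) ^ 2 :=
    (measurePreserving_prod_add (volume : Measure (Rn d)) volume).integrable_comp_of_integrable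
      (hg2.mul_prod hg2)
  have hG' : Integrable fun p : Rn d × Rn d => g p.2 ^ 2 * g (p.2 + p.1) ^ 2 := hG.swap
  refine ((hG.add hG').const_mul (Real.exp s * Real.exp t * 2)).mono'
    (measurable_integral_mul_family
      (measurable_occupationFourier hYm hYm' s t)).aestronglyMeasurable
    (Eventually.of_forall fun p => ?_)
  refine (norm_integral_occupationFourier_mul_le hY hY' hYm hYm' hindep s t p.1 p.2).trans ?_
  rw [mul_assoc (Real.exp s * Real.exp t)]
  refine mul_le_mul_of_nonneg_left ?_ (by positivity)
  simp only [Pi.add_apply, add_comm p.2 p.1, ← hgdef]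
  nlinarith [mul_nonneg (sq_nonneg (g (p.1 + p.2))) (sq_nonneg (g p.1 - g p.2))]

/-- The integral `∫_0^s exp (-r a) dr`. -/
noncomputable def expIntegral (s a : ℝ) : ℝ := ∫ r in Set.Ioc 0 s, Real.exp (-r * a)

lemma expIntegral_nonneg (s a : ℝ) : 0 ≤ expIntegral s a :=
  integral_nonneg fun _ => (Real.exp_pos _).le

/-- On `(0,s]` one has `e^{-ra} ≤ e^s e^{-(1+a)r}`; integrate the right side up to infinity. -/
lemma expIntegral_le {s a : ℝ} (ha : 0 ≤ a) :
    expIntegral s a ≤ Real.exp s * (1 + a)⁻¹ := by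
  rw [← ENNReal.ofReal_le_ofReal_iff (by positivity), expIntegral,
    ofReal_integral_eq_lintegral_ofReal (by
      exact (by fun_prop : Continuous fun r : ℝ => Real.exp (-r * a)).integrableOn_Ioc)
      (Eventually.of_forall fun _ => (Real.exp_pos _).le), ENNReal.ofReal_mul (Real.exp_pos _).le,
    ← lintegral_expTail ha, ← lintegral_const_mul _ (by fun_prop)]
  refine le_trans ?_ (setLIntegral_le_lintegral (Set.Ioc 0 s) _)
  refine setLIntegral_mono (by fun_prop) fun r hr => ?_
  rw [expTail_of_nonneg _ hr.1.le, ← ENNReal.ofReal_mul (Real.exp_pos _).le, ← Real.exp_add]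
  refine ENNReal.ofReal_le_ofReal (Real.exp_le_exp.2 ?_)
  linarith [hr.2]

lemma continuous_expIntegral (s : ℝ) : Continuous (expIntegral s) := by
  unfold expIntegral
  simp only [← integral_Icc_eq_integral_Ioc]
  exact continuous_parametric_integral_of_continuous (by fun_prop) isCompact_Icc

lemma IsStableExponent.integrable_expIntegral_mul (hψ : IsStableExponent β ψ) (hβ0 : 0 < β)
    (hβ : (d : ℝ) / 2 < β) (s t : ℝ) :
    Integrable fun ξ => expIntegral s (ψ ξ) * expIntegral t (ψ ξ) := by
  refine ((integrable_invOneAdd_sq hψ hβ0 hβ).const_mul (Real.exp s * Real.exp t)).mono'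
    (((continuous_expIntegral s).comp hψ.continuous).mul
      ((continuous_expIntegral t).comp hψ.continuous)).aestronglyMeasurable
    (Eventually.of_forall fun ξ => ?_)
  rw [Real.norm_of_nonneg (mul_nonneg (expIntegral_nonneg _ _) (expIntegral_nonneg _ _))]
  refine (mul_le_mul (expIntegral_le (hψ.nonneg ξ)) (expIntegral_le (hψ.nonneg ξ))
    (expIntegral_nonneg _ _) (by have := hψ.nonneg ξ; positivity)).trans (le_of_eq ?_)
  rw [invOneAdd]; ring

lemma integral_occupationFourier (hY : IsSymmetricStableProcess P β ψ x Y)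
    (hY' : IsSymmetricStableProcess P β ψ y Y') (hYm : Measurable (Function.uncurry Y))
    (hYm' : Measurable (Function.uncurry Y'))
    (hindep : IndepFun (fun ω r => Y r ω) (fun ω r => Y' r ω) P) (s t : ℝ) (ξ : Rn d) :
    ∫ ω, occupationFourier Y Y' s t ξ ω ∂P =
      ch ξ (x - y) * (expIntegral s (ψ ξ) * expIntegral t (ψ ξ) : ℝ) := by
  simp only [occupationFourier]
  rw [integral_integral_swap]
  · have hae : ∀ᵐ τ ∂timeBox s t, ∫ ω, ch ξ (pairDiff Y Y' τ ω) ∂P =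
        ch ξ (x - y) * ((Real.exp (-τ.1 * ψ ξ) : ℂ) * (Real.exp (-τ.2 * ψ ξ) : ℂ)) := by
      filter_upwards [ae_mem_timeBox s t] with τ hτ
      simp only [pairDiff]
      rw [integral_ch_sub_of_indepFun hY.measurable hY'.measurable hindep, hY.integral_ch,
        hY'.integral_ch, hY.exponent.even, Real.coe_toNNReal _ hτ.1.1.le,
        Real.coe_toNNReal _ hτ.2.1.le, ch_sub_right]
      ring
    rw [integral_congr_ae hae, integral_const_mul, timeBox,
      integral_prod_mul (fun r : ℝ => (Real.exp (-r * ψ ξ) : ℂ))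
        (fun r : ℝ => (Real.exp (-r * ψ ξ) : ℂ)), integral_complex_ofReal,
      integral_complex_ofReal, Complex.ofReal_mul]
    rfl
  · refine Integrable.of_bound (C := 1) (Measurable.aestronglyMeasurable ?_)
      (Eventually.of_forall fun q => by simp [Function.uncurry])
    simp only [Function.uncurry_def]
    fun_prop

end OccupationMoments

/-! ### Evaluation of the time integrals -/

section TimeIntegral

lemma integral_integral_add_rpow {γ : ℝ} (h1 : γ ≠ 1) (h2 : γ < 2) {s t : ℝ} (hs : 0 ≤ s)
    (ht : 0 ≤ t) :
    ∫ r in Set.Ioc 0 s, ∫ u in Set.Ioc 0 t, (r + u) ^ (-γ) =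
      (s ^ (2 - γ) + t ^ (2 - γ) - (s + t) ^ (2 - γ)) / ((γ - 1) * (2 - γ)) := by
  have hγ : 1 - γ ≠ 0 := sub_ne_zero.2 h1.symm
  have hinner : ∀ r ∈ Set.Ioc 0 s, ∫ u in Set.Ioc 0 t, (r + u) ^ (-γ) =
      ((r + t) ^ (1 - γ) - r ^ (1 - γ)) / (1 - γ) := by
    intro r hr
    rw [← intervalIntegral.integral_of_le ht,
      intervalIntegral.integral_comp_add_left (fun v => v ^ (-γ)), integral_rpow]
    · rw [add_zero, neg_add_eq_sub]
    · refine Or.inr ⟨fun h => h1 (neg_injective h), ?_⟩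
      rw [add_zero, Set.uIcc_of_le (by linarith)]
      -- The singularity at 0 lies outside `[r, r+t]` since `r > 0`.
      exact fun h => absurd h.1 (not_le.2 hr.1)
  have hexp : -1 < 1 - γ := by linarith
  rw [setIntegral_congr_fun measurableSet_Ioc hinner, integral_div,
    ← intervalIntegral.integral_of_le hs, intervalIntegral.integral_sub,
    intervalIntegral.integral_comp_add_right (fun v => v ^ (1 - γ)), integral_rpow (Or.inl hexp),
    integral_rpow (Or.inl hexp)]
  · have h3 : 1 - γ + 1 = 2 - γ := by ring
    have h4 : 2 - γ ≠ 0 := by linarith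
    have h5 : γ - 1 ≠ 0 := sub_ne_zero.2 h1
    rw [h3, zero_add, Real.zero_rpow h4]
    field_simp
    ring
  · exact (intervalIntegral.intervalIntegrable_rpow' hexp (a := 0 + t) (b := s + t)).comp_add_right t
      |>.mono_set (by simp)
  · exact intervalIntegral.intervalIntegrable_rpow' hexp

lemma integral_integral_add_inv {s t : ℝ} (hs : 0 ≤ s) (ht : 0 ≤ t) :
    ∫ r in Set.Ioc 0 s, ∫ u in Set.Ioc 0 t, (r + u) ^ (-1 : ℝ) =
      (s + t) * Real.log (s + t) - t * Real.log t - s * Real.log s := by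
  have hinner : ∀ r ∈ Set.Ioc 0 s, ∫ u in Set.Ioc 0 t, (r + u) ^ (-1 : ℝ) =
      Real.log (r + t) - Real.log r := by
    intro r hr
    have hr0 : 0 < r := hr.1
    simp only [Real.rpow_neg_one]
    rw [← intervalIntegral.integral_of_le ht,
      intervalIntegral.integral_comp_add_left (fun v => v⁻¹), add_zero,
      integral_inv_of_pos hr0 (by linarith), Real.log_div (by linarith) hr0.ne']
  rw [setIntegral_congr_fun measurableSet_Ioc hinner,
    ← intervalIntegral.integral_of_le hs, intervalIntegral.integral_sub,
    intervalIntegral.integral_comp_add_right Real.log, integral_log, integral_log]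
  · simp; ring
  · exact (intervalIntegral.intervalIntegrable_log' (a := 0 + t) (b := s + t)).comp_add_right t
      |>.mono_set (by simp)
  · exact intervalIntegral.intervalIntegrable_log'

/-- Unfold both time integrals, apply Fubini, and combine `e^{-rψ} e^{-uψ} = e^{-(r+u)ψ}`; scaling
then extracts `(r+u)^{-d/β}`. -/
lemma IsStableExponent.integral_expIntegral_mul {d : ℕ} {β : ℝ} {ψ : Rn d → ℝ}
    (hψ : IsStableExponent β ψ) (hβ0 : 0 < β) (hβ : (d : ℝ) / 2 < β) (s t : ℝ) :
    ∫ ξ, expIntegral s (ψ ξ) * expIntegral t (ψ ξ) = (∫ ξ, Real.exp (-ψ ξ)) *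
      ∫ r in Set.Ioc 0 s, ∫ u in Set.Ioc 0 t, (r + u) ^ (-((d : ℝ) / β)) := by
  have hprod : ∀ ξ, ∫ τ, Real.exp (-τ.1 * ψ ξ) * Real.exp (-τ.2 * ψ ξ) ∂timeBox s t =
      expIntegral s (ψ ξ) * expIntegral t (ψ ξ) := fun ξ => by
    rw [timeBox, integral_prod_mul (fun r : ℝ => Real.exp (-r * ψ ξ))
      (fun r : ℝ => Real.exp (-r * ψ ξ))]
    rfl
  have hc := hψ.continuous
  have hint : Integrable (fun q : Rn d × (ℝ × ℝ) =>
      Real.exp (-q.2.1 * ψ q.1) * Real.exp (-q.2.2 * ψ q.1)) (volume.prod (timeBox s t)) := by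
    rw [integrable_prod_iff (Continuous.aestronglyMeasurable (by fun_prop))]
    constructor
    · refine Eventually.of_forall fun ξ => ?_
      refine Integrable.of_bound (C := 1) (Continuous.aestronglyMeasurable (by fun_prop)) ?_
      filter_upwards [ae_mem_timeBox s t] with τ hτ
      rw [← Real.exp_add, Real.norm_of_nonneg (Real.exp_pos _).le, Real.exp_le_one_iff]
      nlinarith [hψ.nonneg ξ, hτ.1.1, hτ.2.1, mul_nonneg hτ.1.1.le (hψ.nonneg ξ),
        mul_nonneg hτ.2.1.le (hψ.nonneg ξ)]
    · refine (hψ.integrable_expIntegral_mul hβ0 hβ s t).congr (Eventually.of_forall fun ξ => ?_)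
      simp only [← hprod, norm_mul, Real.norm_of_nonneg (Real.exp_pos _).le]
  have hinner : ∀ᵐ τ ∂timeBox s t,
      ∫ ξ, Real.exp (-τ.1 * ψ ξ) * Real.exp (-τ.2 * ψ ξ) =
        (∫ ξ, Real.exp (-ψ ξ)) * (τ.1 + τ.2) ^ (-((d : ℝ) / β)) := by
    filter_upwards [ae_mem_timeBox s t] with τ hτ
    rw [mul_comm, ← integral_exp_neg_mul_exponent hψ hβ0 (add_pos hτ.1.1 hτ.2.1)]
    refine integral_congr_ae (Eventually.of_forall fun ξ => ?_)
    simp only [← Real.exp_add]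
    congr 1; ring
  have hpos : 0 < ∫ ξ, Real.exp (-ψ ξ) :=
    integral_exp_pos (integrable_exp_neg_exponent hψ hβ0 hβ)
  -- No separate estimate near the origin is needed: Fubini gives integrability of a positive
  -- multiple of this power.
  have hpow : Integrable (fun τ : ℝ × ℝ => (τ.1 + τ.2) ^ (-((d : ℝ) / β))) (timeBox s t) := by
    have := (hint.integral_prod_right).congr hinner
    exact (integrable_const_mul_iff (isUnit_iff_ne_zero.2 hpos.ne') _).1 this
  simp only [← hprod]
  rw [integral_integral_swap hint, integral_congr_ae hinner, integral_const_mul]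
  rw [timeBox] at hpow ⊢
  rw [integral_prod _ hpow]

end TimeIntegral

/-! ### Existence and mean of the intersection local time -/

section IntersectionLocalTime

variable {d : ℕ} {Ω : Type*} [MeasurableSpace Ω] {P : Measure Ω} [IsProbabilityMeasure P]
  {β : ℝ} {ψ : Rn d → ℝ} {x y : Rn d} {X X' : ℝ≥0 → Ω → Rn d} {f : SchwartzMap (Rn d) ℝ}

/-- Existence of the intersection local time, and convergence of the approximate means. -/
lemma exists_isIntersectionLocalTime (hβ0 : 0 < β) (hβ : (d : ℝ) / 2 < β)
    (hX : IsSymmetricStableProcess P β ψ x X) (hX' : IsSymmetricStableProcess P β ψ y X')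
    (hindep : IndepFun (fun ω r => X r ω) (fun ω r => X' r ω) P) (hf : IsMollifier f) {s t : ℝ}
    (hs : 0 ≤ s) (ht : 0 ≤ t) :
    (∃ α : Ω → ℝ, IsIntersectionLocalTime P f X X' s t α) ∧
    Tendsto (fun ε => ∫ ω, approxIntersectionLocalTime f X X' s t ε ω ∂P) (𝓝[>] 0)
      (𝓝 (invTwoPi d * ∫ ξ, (ch ξ (x - y)).re *
        (expIntegral s (ψ ξ) * expIntegral t (ψ ξ)))) := by
  obtain ⟨h, hh⟩ := hf.exists_profile
  obtain ⟨Y, hYm, hYX, hY⟩ := hX.exists_measurable_version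
  obtain ⟨Y', hYm', hYX', hY'⟩ := hX'.exists_measurable_version
  have hindepY : IndepFun (fun ω r => Y r ω) (fun ω r => Y' r ω) P := by
    refine hindep.congr ?_ ?_
    · filter_upwards [hYX] with ω hω
      exact (funext hω).symm
    · filter_upwards [hYX'] with ω hω
      exact (funext hω).symm
  set a : ℝ → Ω → ℝ := fun ε ω => ∫ τ, approxDelta f ε (pairDiff Y Y' τ ω) ∂timeBox s t with ha
  have hae : ∀ ε, approxIntersectionLocalTime f X X' s t ε =ᵐ[P] a ε := by
    intro ε
    filter_upwards [hYX, hYX'] with ω hω hω'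
    exact approxIntersectionLocalTime_eq_integral_timeBox f hYm hYm' hs ht ε hω hω'
  have hLp : ∀ ε, MemLp (a ε) 2 P := memLp_integral_approxDelta f hYm hYm' s t
  have hrep : ∀ ε, 0 < ε → ∀ ω, (a ε ω : ℂ) =
      ∫ ξ, occupationFourier Y Y' s t ξ ω * h (ε • ξ) := fun ε hε ω =>
    integral_approxDelta_pairDiff hh hYm hYm' s t hε ω
  have hBm := measurable_occupationFourier hYm hYm' s t
  constructor
  · obtain ⟨α, hα, hlim⟩ := exists_L1_limit_of_integral_sq_sub hLp
      (tendsto_integral_sq_sub hh hBm (norm_occupationFourier_le s t) hrep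
        (integrable_integral_occupationFourier_mul hβ0 hβ hY hY' hYm hYm' hindepY s t))
    refine ⟨α, hα, fun ε _ => (((hLp ε).integrable (by norm_num)).congr (hae ε).symm), ?_⟩
    refine hlim.congr fun ε => eLpNorm_congr_ae ?_
    filter_upwards [hae ε] with ω hω
    rw [hω]
  · have hmean := integral_occupationFourier hY hY' hYm hYm' hindepY s t
    have hGG := hX.exponent.integrable_expIntegral_mul hβ0 hβ s t
    have hi : Integrable fun ξ => ch ξ (x - y) *
        ((expIntegral s (ψ ξ) * expIntegral t (ψ ξ) : ℝ) : ℂ) :=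
      hGG.ofReal.bdd_mul (c := 1) (Measurable.aestronglyMeasurable (by fun_prop)) (by simp)
    have key := tendsto_integral_superposition (P := P) hh hBm (norm_occupationFourier_le s t) hrep
      (by simpa only [hmean] using hi)
    simp only [hmean] at key
    have hre : (invTwoPi d * ∫ ξ, ch ξ (x - y) *
        ((expIntegral s (ψ ξ) * expIntegral t (ψ ξ) : ℝ) : ℂ) : ℂ).re =
        invTwoPi d * ∫ ξ, (ch ξ (x - y)).re * (expIntegral s (ψ ξ) * expIntegral t (ψ ξ)) := by
      rw [Complex.re_ofReal_mul, ← Complex.reCLM_apply, ← Complex.reCLM.integral_comp_comm hi]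
      simp only [Complex.reCLM_apply, Complex.re_mul_ofReal]
    rw [hre] at key
    refine key.congr fun ε => integral_congr_ae (hae ε).symm

omit [IsProbabilityMeasure P] in
lemma IsIntersectionLocalTime.tendsto_integral {s t : ℝ} {α : Ω → ℝ}
    (hα : IsIntersectionLocalTime P f X X' s t α) :
    Tendsto (fun ε => ∫ ω, approxIntersectionLocalTime f X X' s t ε ω ∂P) (𝓝[>] 0)
      (𝓝 (∫ ω, α ω ∂P)) := by
  refine tendsto_integral_of_L1' α hα.integrable.aestronglyMeasurable ?_ hα.tendsto
  filter_upwards [self_mem_nhdsWithin] with ε hε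
  exact hα.approx_integrable ε hε

lemma IsIntersectionLocalTime.integral_eq (hβ0 : 0 < β) (hβ : (d : ℝ) / 2 < β)
    (hX : IsSymmetricStableProcess P β ψ x X) (hX' : IsSymmetricStableProcess P β ψ y X')
    (hindep : IndepFun (fun ω r => X r ω) (fun ω r => X' r ω) P) (hf : IsMollifier f) {s t : ℝ}
    (hs : 0 ≤ s) (ht : 0 ≤ t) {α : Ω → ℝ} (hα : IsIntersectionLocalTime P f X X' s t α) :
    ∫ ω, α ω ∂P = invTwoPi d * ∫ ξ, (ch ξ (x - y)).re *
      (expIntegral s (ψ ξ) * expIntegral t (ψ ξ)) :=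
  tendsto_nhds_unique hα.tendsto_integral
    (exists_isIntersectionLocalTime hβ0 hβ hX hX' hindep hf hs ht).2

/-- The mean of the intersection local time is largest for processes with a common start. -/
lemma IsIntersectionLocalTime.integral_le (hβ0 : 0 < β) (hβ : (d : ℝ) / 2 < β)
    (hX : IsSymmetricStableProcess P β ψ x X) (hX' : IsSymmetricStableProcess P β ψ y X')
    (hindep : IndepFun (fun ω r => X r ω) (fun ω r => X' r ω) P) (hf : IsMollifier f) {s t : ℝ}
    (hs : 0 ≤ s) (ht : 0 ≤ t) {α : Ω → ℝ} (hα : IsIntersectionLocalTime P f X X' s t α) :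
    ∫ ω, α ω ∂P ≤ invTwoPi d * ∫ ξ, expIntegral s (ψ ξ) * expIntegral t (ψ ξ) ∧
    (x = y → ∫ ω, α ω ∂P = invTwoPi d * ∫ ξ, expIntegral s (ψ ξ) * expIntegral t (ψ ξ)) := by
  rw [hα.integral_eq hβ0 hβ hX hX' hindep hf hs ht]
  constructor
  · have hGG := hX.exponent.integrable_expIntegral_mul hβ0 hβ s t
    refine mul_le_mul_of_nonneg_left ?_ (invTwoPi_pos d).le
    have hb : ∀ ξ, ‖(ch ξ (x - y)).re‖ ≤ 1 := fun ξ =>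
      (Complex.abs_re_le_norm _).trans (norm_ch _ _).le
    refine integral_mono (hGG.bdd_mul (c := 1) (Measurable.aestronglyMeasurable (by fun_prop))
      (Eventually.of_forall hb)) hGG fun ξ => ?_
    exact mul_le_of_le_one_left (mul_nonneg (expIntegral_nonneg _ _) (expIntegral_nonneg _ _))
      ((le_abs_self _).trans (hb ξ))
  · rintro rfl
    simp

omit [IsProbabilityMeasure P] in
lemma IsSymmetricStableProcess.charFun_one_sub (hX : IsSymmetricStableProcess P β ψ x X)
    (ξ : Rn d) : charFun (P.map fun ω => X 1 ω - x) ξ = (Real.exp (-ψ ξ) : ℝ) := by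
  have h := hX.charFun_increment 0 1 ξ
  rw [zero_add, NNReal.coe_one, neg_one_mul] at h
  rw [← h]
  congr 1
  refine Measure.map_congr ?_
  filter_upwards [hX.start] with ω hω
  rw [hω]

end IntersectionLocalTime

theorem theorem6 {Ω : Type*} [MeasurableSpace Ω] (P : Measure Ω) [IsProbabilityMeasure P]
    (d : ℕ) (β : ℝ) (hβ : (d : ℝ) / 2 < β) (hβd : β ≤ d)
    (ψ : Rn d → ℝ) (x₀ y₀ : Rn d) (X X' : ℝ≥0 → Ω → Rn d)
    (hX : IsSymmetricStableProcess P β ψ x₀ X)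
    (hX' : IsSymmetricStableProcess P β ψ y₀ X')
    (hindep : IndepFun (fun ω r => X r ω) (fun ω r => X' r ω) P)
    (f : SchwartzMap (Rn d) ℝ) (hf : IsMollifier f)
    (s t : ℝ) (hs : 0 ≤ s) (ht : 0 ≤ t) :
    (∃ p₁ : Rn d → ℝ, IsContinuousDensity (P.map (fun ω => X 1 ω - x₀)) p₁) ∧
    (∃ α : Ω → ℝ, IsIntersectionLocalTime P f X X' s t α) ∧
    ∀ p₁ : Rn d → ℝ, IsContinuousDensity (P.map (fun ω => X 1 ω - x₀)) p₁ →
    ∀ α : Ω → ℝ, IsIntersectionLocalTime P f X X' s t α →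
      (β < d →
        ∫ ω, α ω ∂P ≤ p₁ 0 / (((d : ℝ) / β - 1) * (2 - (d : ℝ) / β)) *
          (s ^ (2 - (d : ℝ) / β) + t ^ (2 - (d : ℝ) / β) - (s + t) ^ (2 - (d : ℝ) / β)) ∧
        (x₀ = y₀ →
          ∫ ω, α ω ∂P = p₁ 0 / (((d : ℝ) / β - 1) * (2 - (d : ℝ) / β)) *
            (s ^ (2 - (d : ℝ) / β) + t ^ (2 - (d : ℝ) / β) - (s + t) ^ (2 - (d : ℝ) / β)))) ∧
      (β = d →
        ∫ ω, α ω ∂P ≤ p₁ 0 *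
          ((s + t) * Real.log (s + t) - t * Real.log t - s * Real.log s) ∧
        (x₀ = y₀ →
          ∫ ω, α ω ∂P = p₁ 0 *
            ((s + t) * Real.log (s + t) - t * Real.log t - s * Real.log s))) := by
  have hβ0 : 0 < β := lt_of_le_of_lt (by positivity) hβ
  have hd : (0 : ℝ) < d := hβ0.trans_le hβd
  have hψ := hX.exponent
  have hφi := integrable_exp_neg_exponent hψ hβ0 hβ
  have hprob : IsProbabilityMeasure (P.map fun ω => X 1 ω - x₀) :=
    Measure.isProbabilityMeasure_map ((hX.measurable 1).sub_const x₀).aemeasurable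
  obtain ⟨h, hh⟩ := hf.exists_profile
  have hφc : Continuous fun ξ => Real.exp (-ψ ξ) := Real.continuous_exp.comp hψ.continuous.neg
  have hdens := isContinuousDensity_inversionIntegral hf hh hφc hφi hX.charFun_one_sub
  refine ⟨⟨_, hdens⟩, (exists_isIntersectionLocalTime hβ0 hβ hX hX' hindep hf hs ht).1,
    fun p₁ hp₁ α hα => ?_⟩
  -- Uniqueness of continuous densities identifies the given `p₁` with the inversion integral,
  -- evaluated at 0.
  have hp0 : p₁ 0 = invTwoPi d * ∫ ξ, Real.exp (-ψ ξ) := by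
    rw [hp₁.unique hdens]
    simp only [inversionIntegral, ch_zero_right, one_mul]
    rw [Complex.re_ofReal_mul, integral_complex_ofReal, Complex.ofReal_re]
  have hmain := hα.integral_le hβ0 hβ hX hX' hindep hf hs ht
  rw [hψ.integral_expIntegral_mul hβ0 hβ, ← mul_assoc, ← hp0] at hmain
  constructor
  · intro hlt
    have h1 : (d : ℝ) / β ≠ 1 := (ne_of_gt ((one_lt_div hβ0).2 hlt))
    have h2 : (d : ℝ) / β < 2 := by rw [div_lt_iff₀ hβ0]; linarith
    rw [integral_integral_add_rpow h1 h2 hs ht] at hmain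
    rwa [div_mul_eq_mul_div, ← mul_div_assoc']
  · intro heq
    rw [heq, div_self hd.ne', integral_integral_add_inv hs ht] at hmain
    exact hmain
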